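/- Let $n\ge 1$. For compositions $a=a_1|\cdots|a_m$ and $b=b_1|\cdots|b_t$ of $n$, the *seaweed* $\frac{a_1|\cdots|a_m}{b_1|\cdots|b_t}$ is the Lie algebra of all complex $n\times n$ matrices of trace zero that preserve each of the subspaces $V_i=\mathrm{span}\{e_1,\dots,e_{a_1+\cdots+a_i}\}$ $(1\le i\le m)$ and $W_j=\mathrm{span}\{e_{b_1+\cdots+b_j+1},\dots,e_n\}$ $(0\le j\le t)$ of $\mathbb{C}^n$. The *index* of a finite-dimensional complex Lie algebra $\mathfrak g$ is $\operatorname{ind}(\mathfrak g)=\min_{f\in\mathfrak g^*}\dim\ker B_f$, where $B_f(x,y)=f([x,y])$. A partition $\lambda=(\lambda_1\ge\lambda_2\ge\cdots\ge\lambda_m)$ of $n$ is called *Frobenius* if the seaweed $\frac{\lambda_1|\cdots|\lambda_m}{n}$ has index $0$. Let $\mathcal P(n,d)$ be the set of Frobenius partitions of $n$ all of whose parts are at most $d$. **Theorem.** If $d\in\{1,2,3,4\}$, then $|\mathcal P(n,d)|$ is an eventually periodic function of $n$. More precisely: - if $n\ge 3$, then $|\mathcal P(n,1)|=0$; - if $n\ge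 5$, then $|\mathcal P(n,2)|=1$ for $n$ odd and $|\mathcal P(n,2)|=0$ for $n$ even; - if $n\ge 13$, then $|\mathcal P(n,3)|=2$ for $n$ odd and $|\mathcal P(n,3)|=0$ for $n$ even; - if $n\ge 17$, then $|\mathcal P(n,4)|=4,\ 2,\ 3,\ 0$ for $n\equiv 1,\ 2,\ 3,\ 0\pmod 4$, respectively. -/

import Mathlib

namespace Seaweed

noncomputable section

attribute [local instance] LieRing.ofAssociativeRing

/-- The Kirillov form `B_f(x, y) = f ⁅x, y⁆` of a linear form `f` on a Lie algebra. -/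
def kirillovForm {K L : Type*} [Field K] [LieRing L] [LieAlgebra K L] (f : Module.Dual K L) :
    L →ₗ[K] L →ₗ[K] K :=
  LinearMap.mk₂ K (fun x y => f ⁅x, y⁆)
    (fun x x' y => by rw [add_lie, map_add])
    (fun c x y => by rw [smul_lie, map_smul])
    (fun x y y' => by rw [lie_add, map_add])
    (fun c x y => by rw [lie_smul, map_smul])

/-- The index of a finite-dimensional Lie algebra: the minimum of `dim ker B_f` over all linear
forms `f` (an infimum of a nonempty set of natural numbers, hence attained). -/
def lieIndex (K L : Type*) [Field K] [LieRing L] [LieAlgebra K L] : ℕ :=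
  ⨅ f : Module.Dual K L, Module.finrank K (LinearMap.ker (kirillovForm f))

/-- `V_i = span {e_1, …, e_{a_1 + ⋯ + a_i}}` (the basis is indexed from `0` here). -/
def flagUp {n : ℕ} (a : Composition n) (i : ℕ) : Submodule ℂ (Fin n → ℂ) :=
  Submodule.span ℂ {v | ∃ k : Fin n, (k : ℕ) < a.sizeUpTo i ∧ v = Pi.single k 1}

/-- `W_j = span {e_{b_1 + ⋯ + b_j + 1}, …, e_n}` (the basis is indexed from `0` here). -/
def flagDown {n : ℕ} (b : Composition n) (j : ℕ) : Submodule ℂ (Fin n → ℂ) :=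
  Submodule.span ℂ {v | ∃ k : Fin n, b.sizeUpTo j ≤ (k : ℕ) ∧ v = Pi.single k 1}

/-- The matrices that map a given subspace of `ℂⁿ` into itself. -/
def preserving {n : ℕ} (U : Submodule ℂ (Fin n → ℂ)) :
    LieSubalgebra ℂ (Matrix (Fin n) (Fin n) ℂ) where
  carrier := {A | ∀ v ∈ U, A.mulVec v ∈ U}
  zero_mem' := fun v _ => by rw [Matrix.zero_mulVec]; exact U.zero_mem
  add_mem' := fun {A B} hA hB v hv => by
    rw [Matrix.add_mulVec]; exact U.add_mem (hA v hv) (hB v hv)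
  smul_mem' := fun c A hA v hv => by
    rw [Matrix.smul_mulVec]; exact U.smul_mem c (hA v hv)
  lie_mem' := fun {A B} hA hB v hv => by
    rw [Ring.lie_def, Matrix.sub_mulVec, ← Matrix.mulVec_mulVec, ← Matrix.mulVec_mulVec]
    exact U.sub_mem (hA _ (hB v hv)) (hB _ (hA v hv))

/-- The seaweed of type `a_1|⋯|a_m / b_1|⋯|b_t`: the trace-zero complex matrices that preserve
both flags `V_i` and `W_j`. -/
def seaweed {n : ℕ} (a b : Composition n) : LieSubalgebra ℂ (Matrix (Fin n) (Fin n) ℂ) :=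
  LieAlgebra.SpecialLinear.sl (Fin n) ℂ ⊓
    ((⨅ i : ℕ, preserving (flagUp a i)) ⊓ (⨅ j : ℕ, preserving (flagDown b j)))

/-- A partition, its parts listed in non-increasing order, as a composition. -/
def toComposition {n : ℕ} (p : n.Partition) : Composition n where
  blocks := p.parts.sort (· ≥ ·)
  blocks_pos := fun {_} hi => p.parts_pos ((Multiset.mem_sort _).1 hi)
  blocks_sum := by rw [← Multiset.sum_coe, Multiset.sort_eq, p.parts_sum]

/-- The index of a pair of partitions of `n`. -/
def pairIndex {n : ℕ} (p q : n.Partition) : ℕ :=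
  lieIndex ℂ (seaweed (toComposition p) (toComposition q))

/-- A partition of `n` is Frobenius if its index relative to the one-part partition `(n)` is `0`. -/
def IsFrobenius {n : ℕ} (p : n.Partition) : Prop :=
  pairIndex p (Nat.Partition.indiscrete n) = 0

/-- The set of Frobenius partitions of `n` with all parts at most `d`. -/
def frobeniusPartitions (n d : ℕ) : Set n.Partition :=
  {p | IsFrobenius p ∧ ∀ k ∈ p.parts, k ≤ d}

end

end Seaweed

/-! A Lie algebra has index 0 exactly when some linear form has a nondegenerate Kirillov form. For a
seaweed, write the form as a trace pairing with a matrix `f` and let `P` be the relation of allowed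
matrix positions. Nondegeneracy then says that only scalar matrices are supported on the transpose
of `P` and commute with `f` at the positions of `P` (`lieIndex_seaweed_eq_zero_iff`).

This condition is open in `f` and stable under conjugation by the invertible matrices attached to
`P`. Hence one square block of `f` may be taken to be the identity and a neighbouring block zero.
The commutation equations then eliminate some blocks of the unknown matrix and leave the same
problem for a smaller seaweed. On leading blocks `x` (above) and `y` (below) this gives two moves:
x|a / y|b becomes a / (y-2x)|x|b if 2x ≤ y (`frob_short`), and (2x-y)|a / x|b if x ≤ y ≤ 2x
(`frob_long`). The moves stop at the 1×1 case, which is Frobenius, or at one of two obstructions: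
proper prefixes of equal sum, which split the seaweed, or sl_n with n ≥ 2.

Folding λ = L M R over n (`frob_fold`) makes the smallest parts, read from the end of R, face the
largest parts L. If R and L have equal sums the seaweed splits; for several other pairs (R, L) a few
moves expose equal prefixes, whatever the remaining parts are. For large n only the shapes 2^k 1, 3
2^k, 4^k 1, 4^k 1 1, 4^k 3 2, 4^k 3, 4^k 3 3 and 4^k 2 escape these local obstructions. Descents
that strip off equal parts show that all of them are Frobenius except 4^k 2, which descends to sl_2.
Counting the shapes of total n by residue gives the theorem. -/

namespace Seaweed

/-! ### Centralizers of a form: symmetries and genericity. -/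

open Matrix Filter Topology

/-- `y` is supported on the transpose of `P` and commutes with `f` on the positions in `P`. -/
def Centralizes {ι : Type*} [Fintype ι] (P : ι → ι → Prop) (f y : Matrix ι ι ℂ) : Prop :=
  (∀ i j, y i j ≠ 0 → P j i) ∧ ∀ i j, P i j → (y * f) i j = (f * y) i j

/-- Only scalar matrices centralize `f`. -/
def IsFrobWitness {ι : Type*} [Fintype ι] [DecidableEq ι] (P : ι → ι → Prop)
    (f : Matrix ι ι ℂ) : Prop :=
  ∀ y, Centralizes P f y → ∃ c : ℂ, y = c • (1 : Matrix ι ι ℂ)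

/-- The incidence algebra of `P`, modulo scalars, is a Frobenius Lie algebra. -/
def FrobRel {ι : Type*} [Fintype ι] [DecidableEq ι] (P : ι → ι → Prop) : Prop :=
  ∃ f, IsFrobWitness P f

/-- The injective continuous linear maps form an open set when the source is finite-dimensional, and
a line through `A` meets it in a neighbourhood of the parameter 0. -/
theorem eventually_injective_add_smul {V W : Type*} [NormedAddCommGroup V] [NormedSpace ℂ V]
    [FiniteDimensional ℂ V] [NormedAddCommGroup W] [NormedSpace ℂ W] {A : V →ₗ[ℂ] W}
    (hA : Function.Injective A) (B : V →ₗ[ℂ] W) :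
    ∀ᶠ t : ℂ in 𝓝 0, Function.Injective (A + t • B) := by
  have hcont : Continuous fun t : ℂ =>
      LinearMap.toContinuousLinearMap A + t • LinearMap.toContinuousLinearMap B := by
    fun_prop
  have hopen := (ContinuousLinearMap.isOpen_injective (𝕜 := ℂ) (E := V) (F := W)).preimage hcont
  have h0 : (0 : ℂ) ∈ (fun t : ℂ => LinearMap.toContinuousLinearMap A +
      t • LinearMap.toContinuousLinearMap B) ⁻¹' {L | Function.Injective L} := by
    rw [Set.mem_preimage, zero_smul, add_zero]
    exact hA
  filter_upwards [hopen.mem_nhds h0] with t ht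
  exact ht

section General

variable {ι κ : Type*} [Fintype ι] [DecidableEq ι] [Fintype κ] [DecidableEq κ]

theorem FrobRel.transpose {P : ι → ι → Prop} (h : FrobRel P) : FrobRel (fun i j => P j i) := by
  obtain ⟨f, hf⟩ := h
  refine ⟨fᵀ, fun y hy => ?_⟩
  obtain ⟨c, hc⟩ := hf yᵀ ⟨fun i j h => hy.1 j i h, fun i j h => by
    have := hy.2 j i h
    have e1 : (yᵀ * f) i j = (fᵀ * y) j i := by
      rw [← Matrix.transpose_apply (fᵀ * y), Matrix.transpose_mul, Matrix.transpose_transpose]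
    have e2 : (f * yᵀ) i j = (y * fᵀ) j i := by
      rw [← Matrix.transpose_apply (y * fᵀ), Matrix.transpose_mul, Matrix.transpose_transpose]
    rw [e1, e2, this]⟩
  refine ⟨c, ?_⟩
  rw [← Matrix.transpose_transpose y, hc]
  simp

theorem FrobRel.of_equiv {P : ι → ι → Prop} {Q : κ → κ → Prop} (e : ι ≃ κ)
    (he : ∀ i j, P i j ↔ Q (e i) (e j)) (h : FrobRel P) : FrobRel Q := by
  obtain ⟨f, hf⟩ := h
  refine ⟨f.submatrix e.symm e.symm, fun y hy => ?_⟩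
  obtain ⟨c, hc⟩ := hf (y.submatrix e e) ⟨fun i j h => (he j i).2 (hy.1 _ _ h), fun i j h => by
    have h2 := hy.2 _ _ ((he i j).1 h)
    have hfe : f = (f.submatrix e.symm e.symm).submatrix e e := by simp
    rw [hfe, Matrix.submatrix_mul_equiv, Matrix.submatrix_mul_equiv]
    exact h2⟩
  refine ⟨c, ?_⟩
  have : y = (y.submatrix e e).submatrix e.symm e.symm := by simp
  rw [this, hc]
  ext i j
  simp [Matrix.one_apply]

theorem frobRel_congr {P : ι → ι → Prop} {Q : κ → κ → Prop} (e : ι ≃ κ)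
    (he : ∀ i j, P i j ↔ Q (e i) (e j)) : FrobRel P ↔ FrobRel Q :=
  ⟨FrobRel.of_equiv e he, FrobRel.of_equiv e.symm fun i j => by simp [he]⟩

/-- If `y` centralizes `g * f * g'`, then `g' * y * g` centralizes `f`; transitivity of `P` keeps
supports and tested positions inside the relation. -/
theorem IsFrobWitness.conj {P : ι → ι → Prop} (htr : ∀ i j k, P i j → P j k → P i k)
    {f g g' : Matrix ι ι ℂ} (hf : IsFrobWitness P f) (hg : ∀ i j, g i j ≠ 0 → P j i)
    (hg' : ∀ i j, g' i j ≠ 0 → P j i) (h1 : g * g' = 1) (h2 : g' * g = 1) :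
    IsFrobWitness P (g * f * g') := by
  have supp : ∀ a b : Matrix ι ι ℂ, (∀ i j, a i j ≠ 0 → P j i) → (∀ i j, b i j ≠ 0 → P j i) →
      ∀ i j, (a * b) i j ≠ 0 → P j i := by
    intro a b ha hb i j h
    rw [Matrix.mul_apply] at h
    obtain ⟨k, -, hk⟩ := Finset.exists_ne_zero_of_sum_ne_zero h
    exact htr _ _ _ (hb _ _ (right_ne_zero_of_mul hk)) (ha _ _ (left_ne_zero_of_mul hk))
  intro y hy
  obtain ⟨c, hc⟩ := hf (g' * y * g) ⟨supp _ _ (supp _ _ hg' hy.1) hg, fun i j hij => by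
    have key : g' * y * g * f - f * (g' * y * g) =
        g' * (y * (g * f * g') - g * f * g' * y) * g := by
      have e1 : g' * (y * (g * f * g') - g * f * g' * y) * g =
          g' * y * g * f * (g' * g) - (g' * g) * f * (g' * y * g) := by noncomm_ring
      rw [e1, h2]; simp
    have : (g' * (y * (g * f * g') - g * f * g' * y) * g) i j = 0 := by
      rw [Matrix.mul_apply]
      refine Finset.sum_eq_zero fun l _ => ?_
      rw [Matrix.mul_apply, Finset.sum_mul]
      refine Finset.sum_eq_zero fun k _ => ?_
      by_cases ha : g' i k = 0
      · simp [ha]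
      by_cases hb : g l j = 0
      · simp [hb]
      have := hy.2 k l (htr _ _ _ (hg' _ _ ha) (htr _ _ _ hij (hg _ _ hb)))
      simp [this]
    rw [← key, Matrix.sub_apply, sub_eq_zero] at this
    exact this⟩
  refine ⟨c, ?_⟩
  have : y = g * (g' * y * g) * g' := by
    have e : g * (g' * y * g) * g' = (g * g') * y * (g * g') := by noncomm_ring
    rw [e, h1]; simp
  rw [this, hc]
  simp [h1]

/-- Being a witness is an open condition, along any line. -/
theorem IsFrobWitness.eventually [Nonempty ι] {P : ι → ι → Prop} (hrefl : ∀ i, P i i)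
    {f : Matrix ι ι ℂ} (hf : IsFrobWitness P f) (f₁ : Matrix ι ι ℂ) :
    ∀ᶠ t : ℂ in 𝓝 0, IsFrobWitness P (f + t • f₁) := by
  classical
  obtain ⟨i₀⟩ := ‹Nonempty ι›
  let Y : Submodule ℂ (ι → ι → ℂ) :=
    { carrier := {y | ∀ i j, ¬ P j i → y i j = 0}
      zero_mem' := fun _ _ _ => rfl
      add_mem' := fun {a b} ha hb i j h => by simp [ha i j h, hb i j h]
      smul_mem' := fun c a ha i j h => by simp [ha i j h] }
  -- The kernel of `T g` is the space of centralizing matrices, which contains the scalars. The map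
  -- `E` below reads one diagonal entry in a separate coordinate and so excludes nonzero scalars:
  -- `g` is a witness exactly when `T g + E` is injective.
  let T : Matrix ι ι ℂ → (Y →ₗ[ℂ] ((ι → ι → ℂ) × ℂ)) := fun f =>
    { toFun := fun y => (fun i j => if P i j then
          (Matrix.of y.1 * f) i j - (f * Matrix.of y.1) i j else 0, 0)
      map_add' := fun a b => by
        refine Prod.ext ?_ (by simp)
        funext i j
        by_cases h : P i j
        · simp [h, Matrix.mul_apply, add_mul, mul_add, Finset.sum_add_distrib]; ring
        · simp [h]
      map_smul' := fun c a => by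
        refine Prod.ext ?_ (by simp)
        funext i j
        by_cases h : P i j
        · simp [h, Matrix.mul_apply, mul_assoc, ← Finset.mul_sum, mul_left_comm _ c, mul_sub]
        · simp [h] }
  let E : Y →ₗ[ℂ] ((ι → ι → ℂ) × ℂ) :=
    { toFun := fun y => (0, y.1 i₀ i₀)
      map_add' := fun a b => by simp
      map_smul' := fun c a => by simp }
  have hker : ∀ g (y : Y), (T g + E) y = 0 →
      Centralizes P g (Matrix.of y.1) ∧ y.1 i₀ i₀ = 0 := by
    intro g y h
    have h1 := congrArg Prod.fst h
    have h2 := congrArg Prod.snd h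
    refine ⟨⟨fun i j hij => by_contra fun hP => hij (y.2 i j hP), fun i j hij => ?_⟩,
      by simpa [T, E] using h2⟩
    have := congrFun (congrFun h1 i) j
    simpa [T, E, hij, sub_eq_zero] using this
  have hinj : ∀ g, IsFrobWitness P g → Function.Injective (T g + E) := by
    intro g hg
    rw [← LinearMap.ker_eq_bot, LinearMap.ker_eq_bot']
    intro y hy
    obtain ⟨hy1, hy2⟩ := hker g y hy
    obtain ⟨c, hc⟩ := hg _ hy1
    have hc0 : c = 0 := by
      have := congrFun (congrFun hc i₀) i₀
      simpa [hy2] using this.symm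
    apply Subtype.ext
    funext i j
    have := congrFun (congrFun hc i) j
    simpa [hc0] using this
  have hwit : ∀ g, Function.Injective (T g + E) → IsFrobWitness P g := by
    intro g hg y hy
    refine ⟨y i₀ i₀, ?_⟩
    -- Subtracting the scalar with the same `i₀` entry gives an element of the kernel; reflexivity
    -- of `P` makes scalars admissible.
    let z : Y := ⟨fun i j => (y - y i₀ i₀ • (1 : Matrix ι ι ℂ)) i j, fun i j h => by
      have h1 : y i j = 0 := by_contra fun h0 => h (hy.1 i j h0)
      have h2 : i ≠ j := by rintro rfl; exact h (hrefl i)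
      simp [h1, h2]⟩
    have hz : (T g + E) z = 0 := by
      have e : Matrix.of z.1 = y - y i₀ i₀ • (1 : Matrix ι ι ℂ) := rfl
      refine Prod.ext ?_ ?_
      · funext i j
        by_cases h : P i j
        · have := hy.2 i j h
          simp [T, E, e, h, sub_mul, mul_sub, this]
        · simp [T, E, h]
      · simp [T, E, z]
    have hz0 : z = 0 := hg (by rw [hz, map_zero])
    have : y - y i₀ i₀ • (1 : Matrix ι ι ℂ) = 0 := by
      ext i j
      exact congrFun (congrFun (congrArg Subtype.val hz0) i) j
    exact sub_eq_zero.1 this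
  have hline : ∀ t : ℂ, T (f + t • f₁) + E = T f + E + t • T f₁ := by
    intro t
    refine LinearMap.ext fun y => Prod.ext ?_ (by simp [T, E])
    funext i j
    by_cases h : P i j
    · simp [T, E, h, mul_add, add_mul]; ring
    · simp [T, E, h]
  filter_upwards [eventually_injective_add_smul (hinj f hf) (T f₁)] with t ht
  apply hwit
  rw [hline]
  exact ht

end General

/-- The determinant is the characteristic polynomial of `-M` at `t`, which has finitely many roots;
a punctured neighbourhood of 0 avoids them. -/
theorem eventually_det_add_smul_one_ne_zero {σ : Type*} [Fintype σ] [DecidableEq σ]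
    (M : Matrix σ σ ℂ) : ∀ᶠ t : ℂ in 𝓝[≠] 0, (M + t • (1 : Matrix σ σ ℂ)).det ≠ 0 := by
  have hfin : {t : ℂ | (-M).charpoly.IsRoot t}.Finite :=
    Polynomial.finite_setOfPred_isRoot (-M).charpoly_monic.ne_zero
  have : ∀ᶠ t : ℂ in 𝓝[≠] 0, t ∉ {t : ℂ | (-M).charpoly.IsRoot t} \ {0} := by
    apply eventually_nhdsWithin_of_eventually_nhds
    exact (hfin.subset Set.sdiff_subset).isClosed.isOpen_compl.mem_nhds (by simp)
  filter_upwards [this, self_mem_nhdsWithin] with t ht ht0 h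
  refine ht ⟨?_, ht0⟩
  simp only [Set.mem_ofPred_eq, Polynomial.IsRoot, Matrix.eval_charpoly]
  rw [← h]
  congr 1
  rw [sub_neg_eq_add, add_comm]
  congr 1
  ext i j
  simp [Matrix.scalar_apply, Matrix.diagonal_apply, Matrix.one_apply]

end Seaweed

namespace Seaweed

open Matrix Filter Topology Sum

/-! ### Removing a block at most half as long as the opposite one. -/

section Contraction

variable {σ κ ο : Type*} [Fintype σ] [DecidableEq σ] [Fintype κ] [DecidableEq κ]
  [Fintype ο] [DecidableEq ο]

/-- The shape of the position relation of a seaweed whose first upper block `σ` is at most half as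
long as the first lower block `σ ⊕ κ ⊕ σ`, and the relation `Q` left after removing the block. -/
structure ShortBlock (P : σ ⊕ (κ ⊕ (σ ⊕ ο)) → σ ⊕ (κ ⊕ (σ ⊕ ο)) → Prop)
    (Q : κ ⊕ (σ ⊕ ο) → κ ⊕ (σ ⊕ ο) → Prop) : Prop where
  refl : ∀ i, P i i
  trans : ∀ i j k, P i j → P j k → P i k
  ss : ∀ s t, P (inl s) (inl t)
  sk : ∀ s k, P (inl s) (inr (inl k))
  sj : ∀ s t, P (inl s) (inr (inr (inl t)))
  so : ∀ s o, ¬ P (inl s) (inr (inr (inr o)))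
  rs : ∀ i s, ¬ P (inr i) (inl s)
  kj : ∀ k t, P (inr (inl k)) (inr (inr (inl t)))
  ko : ∀ k o, ¬ P (inr (inl k)) (inr (inr (inr o)))
  jo : ∀ t o, ¬ P (inr (inr (inl t))) (inr (inr (inr o)))
  q : ∀ i j, Q i j ↔ P (inr i) (inr j) ∧ ¬ ((∃ k, i = inl k) ∧ ∃ t, j = inr (inl t))

/-- The form on the reduced seaweed. -/
def shortForm (f : Matrix (σ ⊕ (κ ⊕ (σ ⊕ ο))) (σ ⊕ (κ ⊕ (σ ⊕ ο))) ℂ) :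
    Matrix (κ ⊕ (σ ⊕ ο)) (κ ⊕ (σ ⊕ ο)) ℂ := fun i j =>
  match i, j with
  | inr (inl s), inr (inl t) => f (inr (inr (inl s))) (inr (inr (inl t))) + f (inl s) (inl t)
  | i, j => f (inr i) (inr j)

variable {P : σ ⊕ (κ ⊕ (σ ⊕ ο)) → σ ⊕ (κ ⊕ (σ ⊕ ο)) → Prop}
  {Q : κ ⊕ (σ ⊕ ο) → κ ⊕ (σ ⊕ ο) → Prop}

/-- With the normalized rows, the equations at positions in the rows of the first block determine
blocks of `y`: the (third, κ) block vanishes, the third diagonal block equals the first, and the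
(third, first) block is a commutator with the first diagonal block of `f`. Substituting it into the
third diagonal equation adds that block to `f`, which is the correction in `shortForm`. -/
theorem ShortBlock.witness_of_shortForm (h : ShortBlock P Q)
    {f : Matrix (σ ⊕ (κ ⊕ (σ ⊕ ο))) (σ ⊕ (κ ⊕ (σ ⊕ ο))) ℂ}
    (hK : ∀ s k, f (inl s) (inr (inl k)) = 0)
    (hJ : ∀ s t, f (inl s) (inr (inr (inl t))) = (1 : Matrix σ σ ℂ) s t)
    (hf : IsFrobWitness Q (shortForm f)) : IsFrobWitness P f := by
  intro y hy
  have z : ∀ i j, ¬ P j i → y i j = 0 := fun i j hn => by_contra fun h0 => hn (hy.1 i j h0)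
  have zsr : ∀ s i, y (inl s) (inr i) = 0 := fun s i => z _ _ (h.rs i s)
  have zos : ∀ o s, y (inr (inr (inr o))) (inl s) = 0 := fun o s => z _ _ (h.so s o)
  have zok : ∀ o k, y (inr (inr (inr o))) (inr (inl k)) = 0 := fun o k => z _ _ (h.ko k o)
  have zoj : ∀ o t, y (inr (inr (inr o))) (inr (inr (inl t))) = 0 := fun o t => z _ _ (h.jo t o)
  have e := hy.2
  simp only [Matrix.mul_apply, Fintype.sum_sum_type] at e
  have zjk : ∀ s k, y (inr (inr (inl s))) (inr (inl k)) = 0 := fun s k => by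
    have := e _ _ (h.sk s k)
    simpa [zsr, zok, hK, hJ, Matrix.one_apply] using this.symm
  have ejj : ∀ s t, y (inr (inr (inl s))) (inr (inr (inl t))) = y (inl s) (inl t) := fun s t => by
    have := e _ _ (h.sj s t)
    simpa [zsr, zoj, hK, hJ, Matrix.one_apply] using this.symm
  have pj : ∀ s t, y (inr (inr (inl s))) (inl t) =
      ∑ u, y (inl s) (inl u) * f (inl u) (inl t) - ∑ u, f (inl s) (inl u) * y (inl u) (inl t) :=
    fun s t => by
    have := e _ _ (h.ss s t)
    simp [zsr, zos, hK, hJ, Matrix.one_apply] at this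
    linear_combination - this
  obtain ⟨c, hc⟩ := hf (y.submatrix inr inr) ⟨fun i j hij => (h.q _ _).2 ⟨hy.1 _ _ hij, by
      rintro ⟨⟨k, rfl⟩, t, rfl⟩
      exact hij (zjk t k)⟩, fun i j hij => by
    have hp := ((h.q _ _).1 hij).1
    have hne := ((h.q _ _).1 hij).2
    have := e _ _ hp
    simp only [Matrix.mul_apply, Fintype.sum_sum_type, Matrix.submatrix_apply]
    rcases i with k | s | o <;> rcases j with k' | s' | o'
    · simpa [zsr, zok, zoj, zjk, hK, hJ, shortForm] using this
    · exact absurd ⟨⟨_, rfl⟩, _, rfl⟩ hne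
    · exact absurd hp (h.ko _ _)
    · simpa [zsr, zok, zoj, zjk, hK, hJ, shortForm] using this
    · simp [zsr, zoj, zjk, hJ, shortForm, ejj, pj, Matrix.one_apply, mul_add, add_mul,
        Finset.sum_add_distrib] at this ⊢
      linear_combination this
    · exact absurd hp (h.jo _ _)
    · simpa [zsr, zok, zoj, zjk, zos, hK, hJ, shortForm] using this
    · simpa [zsr, zok, zoj, zjk, zos, hK, hJ, shortForm] using this
    · simpa [zsr, zok, zoj, zjk, zos, hK, hJ, shortForm] using this⟩
  have hc' : ∀ i j, y (inr i) (inr j) = (c • (1 : Matrix _ _ ℂ)) i j :=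
    fun i j => congrFun (congrFun hc i) j
  have hss : ∀ s t, y (inl s) (inl t) = (c • (1 : Matrix σ σ ℂ)) s t := fun s t => by
    rw [← ejj, hc']; simp [Matrix.one_apply]
  -- The positions from κ to the third block are the ones missing from `Q`; their equations
  -- determine this last block.
  have pk : ∀ k s, y (inr (inl k)) (inl s) = 0 := fun k s => by
    have := e _ _ (h.kj k s)
    simpa [zsr, zos, hK, hJ, hc', Matrix.one_apply, mul_comm] using this
  refine ⟨c, ?_⟩
  ext i j
  rcases i with s | i <;> rcases j with t | j
  · rw [hss]; simp [Matrix.one_apply]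
  · rw [zsr]; simp
  · rcases i with k | s | o
    · rw [pk]; simp
    · rw [pj]; simp [hss, Matrix.one_apply, mul_comm]
    · rw [zos]; simp
  · rw [hc']; simp [Matrix.one_apply]

/-- Extension of a matrix centralizing the reduced form to one centralizing the form itself. -/
def shortExtend (f : Matrix (σ ⊕ (κ ⊕ (σ ⊕ ο))) (σ ⊕ (κ ⊕ (σ ⊕ ο))) ℂ)
    (y : Matrix (κ ⊕ (σ ⊕ ο)) (κ ⊕ (σ ⊕ ο)) ℂ) :
    Matrix (σ ⊕ (κ ⊕ (σ ⊕ ο))) (σ ⊕ (κ ⊕ (σ ⊕ ο))) ℂ := fun i j =>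
  match i, j with
  | inr i, inr j => y i j
  | inl s, inl t => y (inr (inl s)) (inr (inl t))
  | inr (inr (inl s)), inl t =>
      ∑ u, y (inr (inl s)) (inr (inl u)) * f (inl u) (inl t) -
        ∑ u, f (inl s) (inl u) * y (inr (inl u)) (inr (inl t))
  | inr (inl k), inl t =>
      ∑ i, f (inr (inl k)) (inr i) * y i (inr (inl t)) -
        ∑ i, y (inl k) i * f (inr i) (inr (inr (inl t)))
  | _, _ => 0

/-- The eliminated blocks can be reconstructed: `shortExtend` fills them with the values forced by
the equations, so a centralizer of the reduced form lifts and is therefore scalar. -/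
theorem ShortBlock.shortForm_witness (h : ShortBlock P Q)
    {f : Matrix (σ ⊕ (κ ⊕ (σ ⊕ ο))) (σ ⊕ (κ ⊕ (σ ⊕ ο))) ℂ}
    (hK : ∀ s k, f (inl s) (inr (inl k)) = 0)
    (hJ : ∀ s t, f (inl s) (inr (inr (inl t))) = (1 : Matrix σ σ ℂ) s t)
    (hf : IsFrobWitness P f) : IsFrobWitness Q (shortForm f) := by
  intro y hy
  have z : ∀ i j, ¬ Q j i → y i j = 0 := fun i j hn => by_contra fun h0 => hn (hy.1 i j h0)
  have zok : ∀ o k, y (inr (inr o)) (inl k) = 0 :=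
    fun o k => z _ _ fun hq => h.ko k o ((h.q _ _).1 hq).1
  have zoj : ∀ o t, y (inr (inr o)) (inr (inl t)) = 0 :=
    fun o t => z _ _ fun hq => h.jo t o ((h.q _ _).1 hq).1
  have zjk : ∀ s k, y (inr (inl s)) (inl k) = 0 :=
    fun s k => z _ _ fun hq => ((h.q _ _).1 hq).2 ⟨⟨_, rfl⟩, _, rfl⟩
  have e := hy.2
  simp only [Matrix.mul_apply, Fintype.sum_sum_type] at e
  obtain ⟨c, hc⟩ := hf (shortExtend f y) ⟨fun i j hij => by
      rcases i with s | i <;> rcases j with t | j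
      · exact h.ss _ _
      · exact absurd rfl hij
      · rcases i with k | u | o
        · exact h.sk _ _
        · exact h.sj _ _
        · exact absurd rfl hij
      · exact ((h.q _ _).1 (hy.1 i j hij)).1, fun i j hij => by
    simp only [Matrix.mul_apply, Fintype.sum_sum_type]
    rcases i with s | i <;> rcases j with t | j
    · simp [shortExtend, hK, hJ, Matrix.one_apply]
    · rcases j with k | t | o
      · simp [shortExtend, hK, hJ, Matrix.one_apply, zjk, zok]
      · simp [shortExtend, hK, hJ, Matrix.one_apply, zoj]
      · exact absurd hij (h.so _ _)
    · exact absurd hij (h.rs _ _)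
    · rcases i with k | s | o <;> rcases j with k' | s' | o'
      · have := e _ _ ((h.q (inl k) (inl k')).2 ⟨hij, by simp⟩)
        simpa [shortExtend, shortForm, hK, hJ, zok, zjk] using this
      · simp [shortExtend, hJ, zoj, Matrix.one_apply]
      · exact absurd hij (h.ko _ _)
      · have := e _ _ ((h.q (inr (inl s)) (inl k')).2 ⟨hij, by simp⟩)
        simpa [shortExtend, shortForm, hK, hJ, zok, zjk] using this
      · have := e _ _ ((h.q (inr (inl s)) (inr (inl s'))).2 ⟨hij, by simp⟩)
        simp [shortExtend, shortForm, hJ, zoj, zjk, Matrix.one_apply, mul_add, add_mul,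
          Finset.sum_add_distrib] at this ⊢
        linear_combination this
      · exact absurd hij (h.jo _ _)
      all_goals
        have := e _ _ ((h.q (inr (inr o)) _).2 ⟨hij, by simp⟩)
        simpa [shortExtend, shortForm, zok, zjk, zoj] using this⟩
  refine ⟨c, ?_⟩
  ext i j
  have := congrFun (congrFun hc (inr i)) (inr j)
  simpa [shortExtend, Matrix.one_apply] using this

/-- A witness can be perturbed until its block from the first to the third interval is invertible,
then conjugated into the normal form of the two preceding lemmas. -/
theorem ShortBlock.frobRel_iff (h : ShortBlock P Q) : FrobRel P ↔ FrobRel Q := by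
  classical
  constructor
  · intro hP
    cases isEmpty_or_nonempty (σ ⊕ (κ ⊕ (σ ⊕ ο))) with
    | inl he =>
      refine ⟨0, fun y _ => ⟨0, ?_⟩⟩
      ext i
      exact he.elim (inr i)
    | inr hne =>
      obtain ⟨f₀, hf₀⟩ := hP
      let f₁ : Matrix (σ ⊕ (κ ⊕ (σ ⊕ ο))) (σ ⊕ (κ ⊕ (σ ⊕ ο))) ℂ := fun i j =>
        match i, j with
        | inl s, inr (inr (inl t)) => (1 : Matrix σ σ ℂ) s t
        | _, _ => 0
      let J : σ → σ ⊕ (κ ⊕ (σ ⊕ ο)) := fun t => inr (inr (inl t))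
      obtain ⟨t, ht, hdet⟩ := ((eventually_nhdsWithin_of_eventually_nhds
        (hf₀.eventually h.refl f₁)).and
        (eventually_det_add_smul_one_ne_zero (f₀.submatrix inl J))).exists
      set f := f₀ + t • f₁ with hfdef
      set M : Matrix σ σ ℂ := f.submatrix inl J with hM
      have hMdet : IsUnit M.det := by
        rw [isUnit_iff_ne_zero]
        rw [show M = f₀.submatrix inl J + t • (1 : Matrix σ σ ℂ) from rfl]
        exact hdet
      have hM1 := Matrix.nonsing_inv_mul M hMdet
      have hM2 := Matrix.mul_nonsing_inv M hMdet
      set W : Matrix σ κ ℂ := M⁻¹ * f.submatrix inl (fun k => inr (inl k)) with hW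
      have hMW : M * W = f.submatrix inl (fun k => inr (inl k)) := by
        rw [hW, ← Matrix.mul_assoc, hM2, Matrix.one_mul]
      -- `A` rescales the first interval and `w` performs column elimination of κ against the third.
      -- The choice `A = M⁻¹`, `w = W` turns the block `M` into the identity and clears the block
      -- towards κ.
      let G : Matrix σ σ ℂ → Matrix σ κ ℂ →
          Matrix (σ ⊕ (κ ⊕ (σ ⊕ ο))) (σ ⊕ (κ ⊕ (σ ⊕ ο))) ℂ := fun A w =>
        fromBlocks A 0 0 (fromBlocks 1 0 (fromRows w 0) 1)
      have hG : ∀ A B w v, G A w * G B v = G (A * B) (w + v) := by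
        intro A B w v
        ext i j
        rcases i with s | k | s | o <;> rcases j with s' | k' | s' | o' <;>
          simp [G, Matrix.mul_apply, Matrix.one_apply]
      have hG1 : G 1 0 = 1 := by
        ext i j
        rcases i with s | k | s | o <;> rcases j with s' | k' | s' | o' <;>
          simp [G, Matrix.one_apply]
      have hGs : ∀ A w i j, G A w i j ≠ 0 → P j i := by
        intro A w i j
        rcases i with s | k | s | o <;> rcases j with s' | k' | s' | o' <;>
          simp [G, Matrix.one_apply, h.ss, h.kj] <;> rintro rfl <;> exact h.refl _
      have hw := ht.conj h.trans (hGs M⁻¹ W) (hGs M (-W))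
        (by rw [hG, hM1, add_neg_cancel, hG1]) (by rw [hG, hM2, neg_add_cancel, hG1])
      refine ⟨_, h.shortForm_witness ?_ ?_ hw⟩
      · intro s k
        have e1 : ∀ j, (G M⁻¹ W * f) (inl s) j = ∑ u, M⁻¹ s u * f (inl u) j := fun j => by
          simp [G, Matrix.mul_apply]
        have e2 : ∀ t, (G M⁻¹ W * f) (inl s) (inr (inr (inl t))) = (1 : Matrix σ σ ℂ) s t :=
          fun t => by rw [e1, ← hM1, Matrix.mul_apply]; rfl
        have e3 : (G M⁻¹ W * f) (inl s) (inr (inl k)) = W s k := by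
          rw [e1, hW, Matrix.mul_apply]; rfl
        rw [Matrix.mul_apply]
        simp [G, Fintype.sum_sum_type, e2, e3, Matrix.one_apply]
      · intro s t
        have e1 : ∀ j, (G M⁻¹ W * f) (inl s) j = ∑ u, M⁻¹ s u * f (inl u) j := fun j => by
          simp [G, Matrix.mul_apply]
        have e2 : ∀ t, (G M⁻¹ W * f) (inl s) (inr (inr (inl t))) = (1 : Matrix σ σ ℂ) s t :=
          fun t => by rw [e1, ← hM1, Matrix.mul_apply]; rfl
        rw [Matrix.mul_apply]
        simp [G, Fintype.sum_sum_type, e2, Matrix.one_apply]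
  · rintro ⟨g, hg⟩
    refine ⟨fun i j => match i, j with
      | inl s, inr (inr (inl t)) => (1 : Matrix σ σ ℂ) s t
      | inr i, inr j => g i j
      | _, _ => 0, h.witness_of_shortForm (fun _ _ => rfl) (fun _ _ => rfl) ?_⟩
    convert hg using 1
    ext i j
    rcases i with k | s | o <;> rcases j with k' | s' | o' <;> simp [shortForm]

end Contraction

/-! ### Shortening a block at least half as long as the opposite one. -/

section LongContraction

variable {σ τ ο : Type*} [Fintype σ] [DecidableEq σ] [Fintype τ] [DecidableEq τ]
  [Fintype ο] [DecidableEq ο]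

/-- The shape of the position relation of a seaweed whose first upper block `σ ⊕ τ` is shorter than
the first lower block `σ ⊕ τ ⊕ σ`, but at least half as long. -/
structure LongBlock (P : σ ⊕ (τ ⊕ (σ ⊕ ο)) → σ ⊕ (τ ⊕ (σ ⊕ ο)) → Prop) : Prop where
  refl : ∀ i, P i i
  trans : ∀ i j k, P i j → P j k → P i k
  ss : ∀ s t, P (inl s) (inl t)
  st : ∀ s k, P (inl s) (inr (inl k))
  ts : ∀ k s, P (inr (inl k)) (inl s)
  tt : ∀ k l, P (inr (inl k)) (inr (inl l))
  sb : ∀ s t, P (inl s) (inr (inr (inl t)))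
  tb : ∀ k t, P (inr (inl k)) (inr (inr (inl t)))
  so : ∀ s o, ¬ P (inl s) (inr (inr (inr o)))
  tno : ∀ k o, ¬ P (inr (inl k)) (inr (inr (inr o)))
  bo : ∀ t o, ¬ P (inr (inr (inl t))) (inr (inr (inr o)))
  rs : ∀ i s, ¬ P (inr (inr i)) (inl s)
  rt : ∀ i k, ¬ P (inr (inr i)) (inr (inl k))

/-- The form on the reduced seaweed. -/
def longForm (f : Matrix (σ ⊕ (τ ⊕ (σ ⊕ ο))) (σ ⊕ (τ ⊕ (σ ⊕ ο))) ℂ) :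
    Matrix (τ ⊕ (σ ⊕ ο)) (τ ⊕ (σ ⊕ ο)) ℂ := fun i j =>
  match i, j with
  | inl k, inr (inl t) => f (inr (inl k)) (inl t)
  | inr (inl s), inr (inl t) => f (inr (inr (inl s))) (inr (inr (inl t))) + f (inl s) (inl t)
  | i, j => f (inr i) (inr j)

/-- Restriction of a matrix centralizing the form to one centralizing the reduced form. -/
def longRestrict (y : Matrix (σ ⊕ (τ ⊕ (σ ⊕ ο))) (σ ⊕ (τ ⊕ (σ ⊕ ο))) ℂ) :
    Matrix (τ ⊕ (σ ⊕ ο)) (τ ⊕ (σ ⊕ ο)) ℂ := fun i j =>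
  match i, j with
  | inr (inl s), inl k => y (inl s) (inr (inl k))
  | i, j => y (inr i) (inr j)

/-- Extension of a matrix centralizing the reduced form to one centralizing the form itself. -/
def longExtend (f : Matrix (σ ⊕ (τ ⊕ (σ ⊕ ο))) (σ ⊕ (τ ⊕ (σ ⊕ ο))) ℂ)
    (y : Matrix (τ ⊕ (σ ⊕ ο)) (τ ⊕ (σ ⊕ ο)) ℂ) :
    Matrix (σ ⊕ (τ ⊕ (σ ⊕ ο))) (σ ⊕ (τ ⊕ (σ ⊕ ο))) ℂ := fun i j =>
  match i, j with
  | inl s, inl t => y (inr (inl s)) (inr (inl t))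
  | inl s, inr (inl k) => y (inr (inl s)) (inl k)
  | inr (inr (inl s)), inl t =>
      ∑ u, y (inr (inl s)) (inr (inl u)) * f (inl u) (inl t) +
        ∑ k, y (inr (inl s)) (inl k) * f (inr (inl k)) (inl t) -
        ∑ u, f (inl s) (inl u) * y (inr (inl u)) (inr (inl t))
  | inr (inr (inl s)), inr (inl l) =>
      ∑ u, y (inr (inl s)) (inr (inl u)) * f (inl u) (inr (inl l)) +
        ∑ k, y (inr (inl s)) (inl k) * f (inr (inl k)) (inr (inl l)) -
        ∑ u, f (inl s) (inl u) * y (inr (inl u)) (inl l) -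
        ∑ k, f (inl s) (inr (inl k)) * y (inl k) (inl l)
  | inr i, inr j => y i j
  | _, _ => 0

variable {P : σ ⊕ (τ ⊕ (σ ⊕ ο)) → σ ⊕ (τ ⊕ (σ ⊕ ο)) → Prop}

/-- The equations identify the third diagonal block of `y` with the first and kill the (τ, first)
block. The (third, first) and (third, τ) blocks are determined by the rest, so the free (first, τ)
block takes the place of (third, τ) in the reduced matrix, and the first-column block of `f` on τ
takes the place of its third-column block. -/
theorem LongBlock.witness_of_longForm (h : LongBlock P)
    {f : Matrix (σ ⊕ (τ ⊕ (σ ⊕ ο))) (σ ⊕ (τ ⊕ (σ ⊕ ο))) ℂ}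
    (hT : ∀ k t, f (inr (inl k)) (inr (inr (inl t))) = 0)
    (hB : ∀ s t, f (inl s) (inr (inr (inl t))) = (1 : Matrix σ σ ℂ) s t)
    (hf : IsFrobWitness (fun i j => P (inr i) (inr j)) (longForm f)) : IsFrobWitness P f := by
  intro y hy
  have z : ∀ i j, ¬ P j i → y i j = 0 := fun i j hn => by_contra fun h0 => hn (hy.1 i j h0)
  have zsr : ∀ s i, y (inl s) (inr (inr i)) = 0 := fun s i => z _ _ (h.rs i s)
  have ztr : ∀ k i, y (inr (inl k)) (inr (inr i)) = 0 := fun k i => z _ _ (h.rt i k)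
  have zos : ∀ o s, y (inr (inr (inr o))) (inl s) = 0 := fun o s => z _ _ (h.so s o)
  have zot : ∀ o k, y (inr (inr (inr o))) (inr (inl k)) = 0 := fun o k => z _ _ (h.tno k o)
  have zob : ∀ o t, y (inr (inr (inr o))) (inr (inr (inl t))) = 0 := fun o t => z _ _ (h.bo t o)
  have e := hy.2
  simp only [Matrix.mul_apply, Fintype.sum_sum_type] at e
  have zts : ∀ k s, y (inr (inl k)) (inl s) = 0 := fun k s => by
    have := e _ _ (h.tb k s)
    simpa [zsr, ztr, zob, hT, hB, Matrix.one_apply] using this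
  have ebb : ∀ s t, y (inr (inr (inl s))) (inr (inr (inl t))) = y (inl s) (inl t) := fun s t => by
    have := e _ _ (h.sb s t)
    simpa [zsr, ztr, zob, hT, hB, Matrix.one_apply] using this.symm
  have pp : ∀ s t, y (inr (inr (inl s))) (inl t) =
      ∑ u, y (inl s) (inl u) * f (inl u) (inl t) +
        ∑ k, y (inl s) (inr (inl k)) * f (inr (inl k)) (inl t) -
        ∑ u, f (inl s) (inl u) * y (inl u) (inl t) := fun s t => by
    have := e _ _ (h.ss s t)
    simp [zsr, zos, zts, hB, Matrix.one_apply] at this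
    linear_combination - this
  have qq : ∀ s l, y (inr (inr (inl s))) (inr (inl l)) =
      ∑ u, y (inl s) (inl u) * f (inl u) (inr (inl l)) +
        ∑ k, y (inl s) (inr (inl k)) * f (inr (inl k)) (inr (inl l)) -
        ∑ u, f (inl s) (inl u) * y (inl u) (inr (inl l)) -
        ∑ k, f (inl s) (inr (inl k)) * y (inr (inl k)) (inr (inl l)) := fun s l => by
    have := e _ _ (h.st s l)
    simp [zsr, zot, hB, Matrix.one_apply] at this
    linear_combination - this
  obtain ⟨c, hc⟩ := hf (longRestrict y) ⟨fun i j hij => by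
      rcases i with k | s | o <;> rcases j with k' | s' | o'
      case inr.inl.inl => exact h.tb _ _
      all_goals exact hy.1 _ _ hij, fun i j hij => by
    simp only [Matrix.mul_apply, Fintype.sum_sum_type]
    have := e _ _ hij
    rcases i with k | s | o <;> rcases j with k' | s' | o'
    · simp [ztr, zot, zts, hT, longForm, longRestrict] at this ⊢
      linear_combination this
    · have := e _ _ (h.ts k s')
      simp [ztr, zos, zob, zts, hT, ebb, longForm, longRestrict] at this ⊢
      linear_combination this
    · exact absurd hij (h.tno _ _)
    · exact absurd hij (h.rt _ _)
    · simp [zsr, ztr, zob, hT, hB, longForm, longRestrict, ebb, pp, Matrix.one_apply, mul_add,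
        add_mul, Finset.sum_add_distrib] at this ⊢
      linear_combination this
    · exact absurd hij (h.bo _ _)
    · exact absurd hij (h.rt _ _)
    · simpa [zsr, ztr, zos, zot, zob, hT, longForm, longRestrict] using this
    · simpa [zsr, ztr, zos, zot, zob, hT, longForm, longRestrict] using this⟩
  have hc' : ∀ i j, longRestrict y i j = (c • (1 : Matrix _ _ ℂ)) i j :=
    fun i j => congrFun (congrFun hc i) j
  have hss : ∀ s t, y (inl s) (inl t) = (c • (1 : Matrix σ σ ℂ)) s t := fun s t => by
    have := hc' (inr (inl s)) (inr (inl t))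
    rw [← ebb]
    simpa [longRestrict, Matrix.one_apply] using this
  have hst : ∀ s k, y (inl s) (inr (inl k)) = 0 := fun s k => by
    simpa [longRestrict] using hc' (inr (inl s)) (inl k)
  have htt : ∀ k l, y (inr (inl k)) (inr (inl l)) = (c • (1 : Matrix τ τ ℂ)) k l := fun k l => by
    simpa [longRestrict, Matrix.one_apply] using hc' (inl k) (inl l)
  have hrr : ∀ i j, y (inr (inr i)) (inr (inr j)) = (c • (1 : Matrix _ _ ℂ)) i j := fun i j => by
    have := hc' (inr i) (inr j)
    rw [show y (inr (inr i)) (inr (inr j)) = longRestrict y (inr i) (inr j) by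
      rcases i with i | i <;> rcases j with j | j <;> rfl, this]
    simp [Matrix.one_apply]
  refine ⟨c, ?_⟩
  ext i j
  rcases i with s | k | i <;> rcases j with t | l | j
  · rw [hss]; simp [Matrix.one_apply]
  · rw [hst]; simp
  · rw [zsr]; simp
  · rw [zts]; simp
  · rw [htt]; simp [Matrix.one_apply]
  · rw [ztr]; simp
  · rcases i with s | o
    · rw [pp]; simp [hss, hst, Matrix.one_apply, mul_comm]
    · rw [zos]; simp
  · rcases i with s | o
    · rw [qq]; simp [hss, hst, htt, Matrix.one_apply, mul_comm]
    · rw [zot]; simp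
  · rw [hrr]; simp [Matrix.one_apply]

theorem LongBlock.longForm_witness (h : LongBlock P)
    {f : Matrix (σ ⊕ (τ ⊕ (σ ⊕ ο))) (σ ⊕ (τ ⊕ (σ ⊕ ο))) ℂ}
    (hT : ∀ k t, f (inr (inl k)) (inr (inr (inl t))) = 0)
    (hB : ∀ s t, f (inl s) (inr (inr (inl t))) = (1 : Matrix σ σ ℂ) s t)
    (hf : IsFrobWitness P f) : IsFrobWitness (fun i j => P (inr i) (inr j)) (longForm f) := by
  intro y hy
  have z : ∀ i j, ¬ P (inr j) (inr i) → y i j = 0 :=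
    fun i j hn => by_contra fun h0 => hn (hy.1 i j h0)
  have ztr : ∀ k i, y (inl k) (inr i) = 0 := fun k i => z _ _ (h.rt i k)
  have zot : ∀ o k, y (inr (inr o)) (inl k) = 0 := fun o k => z _ _ (h.tno k o)
  have zob : ∀ o t, y (inr (inr o)) (inr (inl t)) = 0 := fun o t => z _ _ (h.bo t o)
  have e := hy.2
  simp only [Matrix.mul_apply, Fintype.sum_sum_type] at e
  obtain ⟨c, hc⟩ := hf (longExtend f y) ⟨fun i j hij => by
      rcases i with s | k | s | o <;> rcases j with s' | k' | s' | o' <;>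
      first
        | exact absurd rfl hij
        | exact h.ss _ _
        | exact h.st _ _
        | exact h.ts _ _
        | exact h.tt _ _
        | exact h.sb _ _
        | exact h.tb _ _
        | exact hy.1 _ _ hij, fun i j hij => by
    simp only [Matrix.mul_apply, Fintype.sum_sum_type]
    rcases i with s | k | s | o <;> rcases j with s' | k' | s' | o'
    case inl.inl =>
      simp [longExtend, hB, Matrix.one_apply]
    case inl.inr.inl =>
      simp [longExtend, hB, zot, Matrix.one_apply]
    case inl.inr.inr.inl => simp [longExtend, hT, hB, Matrix.one_apply, zob, ztr]
    case inr.inl.inl =>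
      have := e _ _ (h.tb k s')
      simpa [longExtend, longForm, ztr, zob, hT] using this
    case inr.inl.inr.inl =>
      have := e _ _ (h.tt k k')
      simp [longExtend, longForm, ztr, zot, hT] at this ⊢
      linear_combination this
    case inr.inl.inr.inr.inl =>
      simp [longExtend, hT, ztr, zob]
    case inr.inr.inl.inr.inr.inl =>
      have := e _ _ hij
      simp [longExtend, longForm, hT, hB, zob, ztr, Matrix.one_apply, mul_add, add_mul,
          Finset.sum_add_distrib] at this ⊢
      linear_combination this
    all_goals
      first
        | exact absurd hij (h.so _ _)
        | exact absurd hij (h.tno _ _)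
        | exact absurd hij (h.bo _ _)
        | exact absurd hij (h.rs _ _)
        | exact absurd hij (h.rt _ _)
        | skip
    all_goals
      have := e _ _ hij
      simpa [longExtend, longForm, ztr, zot, zob] using this⟩
  have hc' : ∀ i j, longExtend f y i j = (c • (1 : Matrix _ _ ℂ)) i j :=
    fun i j => congrFun (congrFun hc i) j
  have hr : ∀ i j, ((∃ s, i = inr (inl s)) ∧ ∃ k, j = inl k) ∨
      y i j = longExtend f y (inr i) (inr j) := by
    rintro (k | s | o) (l | t | o') <;> first | exact Or.inr rfl | simp
  refine ⟨c, ?_⟩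
  ext i j
  rcases hr i j with ⟨⟨s, rfl⟩, k, rfl⟩ | h1
  · have := hc' (inl s) (inr (inl k))
    simpa [longExtend, Matrix.one_apply] using this
  · rw [h1, hc']
    simp [Matrix.one_apply]

/-- As in the short case, a generic perturbation makes the block from the first to the third
interval invertible. Here row elimination clears the block below it, in the rows of τ. -/
theorem LongBlock.frobRel_iff (h : LongBlock P) :
    FrobRel P ↔ FrobRel (fun i j => P (inr i) (inr j)) := by
  classical
  constructor
  · intro hP
    cases isEmpty_or_nonempty (σ ⊕ (τ ⊕ (σ ⊕ ο))) with
    | inl he =>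
      refine ⟨0, fun y _ => ⟨0, ?_⟩⟩
      ext i
      exact he.elim (inr i)
    | inr hne =>
      obtain ⟨f₀, hf₀⟩ := hP
      let f₁ : Matrix (σ ⊕ (τ ⊕ (σ ⊕ ο))) (σ ⊕ (τ ⊕ (σ ⊕ ο))) ℂ := fun i j =>
        match i, j with
        | inl s, inr (inr (inl t)) => (1 : Matrix σ σ ℂ) s t
        | _, _ => 0
      let B : σ → σ ⊕ (τ ⊕ (σ ⊕ ο)) := fun t => inr (inr (inl t))
      obtain ⟨t, ht, hdet⟩ := ((eventually_nhdsWithin_of_eventually_nhds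
        (hf₀.eventually h.refl f₁)).and
        (eventually_det_add_smul_one_ne_zero (f₀.submatrix inl B))).exists
      set f := f₀ + t • f₁ with hfdef
      set M : Matrix σ σ ℂ := f.submatrix inl B with hM
      set N : Matrix τ σ ℂ := f.submatrix (fun k => inr (inl k)) B with hN
      have hMdet : IsUnit M.det := by
        rw [isUnit_iff_ne_zero]
        rw [show M = f₀.submatrix inl B + t • (1 : Matrix σ σ ℂ) from rfl]
        exact hdet
      have hM1 := Matrix.nonsing_inv_mul M hMdet
      have hM2 := Matrix.mul_nonsing_inv M hMdet
      let G : Matrix σ σ ℂ → Matrix τ σ ℂ →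
          Matrix (σ ⊕ (τ ⊕ (σ ⊕ ο))) (σ ⊕ (τ ⊕ (σ ⊕ ο))) ℂ := fun A w =>
        fromBlocks A 0 (fromRows w 0) 1
      have hG : ∀ A C w v, G A w * G C v = G (A * C) (w * C + v) := by
        intro A C w v
        ext i j
        rcases i with s | k | s | o <;> rcases j with s' | k' | s' | o' <;>
          simp [G, Matrix.mul_apply, Matrix.one_apply]
      have hG1 : G 1 0 = 1 := by
        ext i j
        rcases i with s | k | s | o <;> rcases j with s' | k' | s' | o' <;>
          simp [G, Matrix.one_apply]
      have hGs : ∀ A w i j, G A w i j ≠ 0 → P j i := by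
        intro A w i j
        rcases i with s | k | s | o <;> rcases j with s' | k' | s' | o' <;>
          simp [G, Matrix.one_apply, h.ss, h.st, h.tt] <;> rintro rfl <;> exact h.refl _
      have hw := ht.conj h.trans (hGs M⁻¹ (-(N * M⁻¹))) (hGs M N)
        (by rw [hG, hM1, Matrix.neg_mul, Matrix.mul_assoc, hM1, Matrix.mul_one, neg_add_cancel,
          hG1])
        (by rw [hG, hM2, add_neg_cancel, hG1])
      refine ⟨_, h.longForm_witness ?_ ?_ hw⟩
      · intro k t
        have e1 : (G M⁻¹ (-(N * M⁻¹)) * f) (inr (inl k)) (inr (inr (inl t))) =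
            (-(N * M⁻¹) * M + N) k t := by
          simp only [G, Matrix.mul_apply, Fintype.sum_sum_type, Matrix.add_apply]
          simp [Matrix.one_apply, hM, hN, B]
        rw [Matrix.mul_apply]
        simp only [Fintype.sum_sum_type]
        simp [G, Matrix.one_apply, e1, Matrix.mul_assoc, hM1]
      · intro s t
        have e1 : (G M⁻¹ (-(N * M⁻¹)) * f) (inl s) (inr (inr (inl t))) =
            (1 : Matrix σ σ ℂ) s t := by
          rw [← hM1]
          simp only [G, Matrix.mul_apply, Fintype.sum_sum_type]
          simp [hM, B]
        rw [Matrix.mul_apply]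
        simp only [Fintype.sum_sum_type]
        simp [G, Matrix.one_apply, e1]
  · rintro ⟨g, hg⟩
    refine ⟨fun i j => match i, j with
      | inl s, inr (inr (inl t)) => (1 : Matrix σ σ ℂ) s t
      | inr (inl k), inl t => g (inl k) (inr (inl t))
      | inr (inl _), inr (inr (inl _)) => 0
      | inr i, inr j => g i j
      | _, _ => 0, h.witness_of_longForm (fun _ _ => rfl) (fun _ _ => rfl) ?_⟩
    convert hg using 1
    ext i j
    rcases i with k | s | o <;> rcases j with k' | s' | o' <;> simp [longForm]

end LongContraction
end Seaweed

/-! ### Block lists, reduction moves and splitting. -/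

namespace Seaweed

open Sum

/-- `up a i j`: every flag subspace for the block sizes `a` that contains `e_j` contains `e_i`. -/
def up : List ℕ → ℕ → ℕ → Prop
  | [], _, _ => True
  | x :: a, i, j => x ≤ i → x ≤ j ∧ up a (i - x) (j - x)

/-- The seaweed with block sizes `a` and `b` is Frobenius. -/
def Frob (n : ℕ) (a b : List ℕ) : Prop :=
  FrobRel fun i j : Fin n => up a i j ∧ up b j i

theorem up_refl : ∀ (a : List ℕ) (i : ℕ), up a i i
  | [], _ => trivial
  | _ :: a, _ => fun h => ⟨h, up_refl a _⟩

theorem up_trans : ∀ (a : List ℕ) {i j k : ℕ}, up a i j → up a j k → up a i k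
  | [], _, _, _, _, _ => trivial
  | _ :: a, _, _, _, h1, h2 => fun h =>
    ⟨(h2 (h1 h).1).1, up_trans a (h1 h).2 (h2 (h1 h).1).2⟩

theorem up_of_le : ∀ (a : List ℕ) {i j : ℕ}, i ≤ j → up a i j
  | [], _, _, _ => trivial
  | _ :: a, _, _, h => fun hx => ⟨hx.trans h, up_of_le a (Nat.sub_le_sub_right h _)⟩

theorem up_cons_of_lt {x i : ℕ} (a : List ℕ) (j : ℕ) (h : i < x) : up (x :: a) i j :=
  fun h' => absurd h' (by omega)

theorem not_up_cons {x i j : ℕ} (a : List ℕ) (hi : x ≤ i) (hj : j < x) : ¬ up (x :: a) i j :=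
  fun h => absurd (h hi).1 (by omega)

theorem up_cons_add (x i j : ℕ) (a : List ℕ) : up (x :: a) (x + i) (x + j) ↔ up a i j := by
  simp [up]

theorem up_iff : ∀ (a : List ℕ) (i j : ℕ),
    up a i j ↔ ∀ k, (a.take k).sum ≤ i → (a.take k).sum ≤ j
  | [], i, j => by simp [up]
  | x :: a, i, j => by
    constructor
    · intro h k hk
      cases k with
      | zero => simp
      | succ k =>
        rw [List.take_succ_cons, List.sum_cons] at hk ⊢
        obtain ⟨h1, h2⟩ := h (by omega)
        have := (up_iff a _ _).1 h2 k (by omega)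
        omega
    · intro h hx
      have h1 : x ≤ j := by simpa using h 1 (by simpa using hx)
      refine ⟨h1, (up_iff a _ _).2 fun k hk => ?_⟩
      have := h (k + 1)
      rw [List.take_succ_cons, List.sum_cons] at this
      have := this (by omega)
      omega

theorem up_reverse_imp {a : List ℕ} {i j n : ℕ} (hn : a.sum = n) (hi : i < n) (hj : j < n)
    (h : up a i j) : up a.reverse (n - (j + 1)) (n - (i + 1)) := by
  rw [up_iff] at h ⊢
  intro k hk
  rw [List.take_reverse, List.sum_reverse] at hk ⊢
  have h2 := List.sum_take_add_sum_drop a (a.length - k)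
  have h3 := h (a.length - k)
  omega

theorem up_reverse {a : List ℕ} {i j n : ℕ} (hn : a.sum = n) (hi : i < n) (hj : j < n) :
    up a.reverse (n - (j + 1)) (n - (i + 1)) ↔ up a i j := by
  refine ⟨fun h => ?_, up_reverse_imp hn hi hj⟩
  have := up_reverse_imp (by rw [List.sum_reverse, hn]) (by omega) (by omega) h
  rw [List.reverse_reverse] at this
  convert this using 1 <;> omega

theorem frob_swap {n : ℕ} {a b : List ℕ} : Frob n a b ↔ Frob n b a := by
  constructor <;> intro h
  · refine FrobRel.of_equiv (Equiv.refl _) (fun i j => ?_) h.transpose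
    exact and_comm
  · refine FrobRel.of_equiv (Equiv.refl _) (fun i j => ?_) h.transpose
    exact and_comm

/-- Reversing the coordinates reverses the direction of both relations; transposing the witness
restores it. -/
theorem frob_reverse {n : ℕ} {a b : List ℕ} (ha : a.sum = n) (hb : b.sum = n) :
    Frob n a b ↔ Frob n a.reverse b.reverse := by
  have key : ∀ {a b : List ℕ}, a.sum = n → b.sum = n → Frob n a b →
      Frob n a.reverse b.reverse := by
    intro a b ha hb h
    refine FrobRel.of_equiv Fin.revPerm (fun i j => ?_) h.transpose
    simp only [Fin.revPerm_apply, Fin.val_rev]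
    rw [up_reverse ha j.2 i.2, up_reverse hb i.2 j.2]
  refine ⟨key ha hb, fun h => ?_⟩
  simpa using key (by rwa [List.sum_reverse]) (by rwa [List.sum_reverse]) h

theorem frob_zero_left {n : ℕ} {a b : List ℕ} : Frob n (0 :: a) b ↔ Frob n a b := by
  simp [Frob, up]

theorem frob_zero_right {n : ℕ} {a b : List ℕ} : Frob n a (0 :: b) ↔ Frob n a b := by
  simp [Frob, up]

/-- The index set of a seaweed split into four consecutive intervals. -/
def splitEquiv (p q r m : ℕ) :
    Fin p ⊕ (Fin q ⊕ (Fin r ⊕ Fin m)) ≃ Fin (p + (q + (r + m))) :=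
  ((Equiv.refl _).sumCongr (((Equiv.refl _).sumCongr finSumFinEquiv).trans finSumFinEquiv)).trans
    finSumFinEquiv

theorem splitEquiv_inl {p q r m : ℕ} (i : Fin p) :
    (splitEquiv p q r m (inl i) : ℕ) = i := by simp [splitEquiv]

theorem splitEquiv_inr_inl {p q r m : ℕ} (i : Fin q) :
    (splitEquiv p q r m (inr (inl i)) : ℕ) = p + i := by simp [splitEquiv]

theorem splitEquiv_inr_inr_inl {p q r m : ℕ} (i : Fin r) :
    (splitEquiv p q r m (inr (inr (inl i))) : ℕ) = p + (q + i) := by simp [splitEquiv]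

theorem splitEquiv_inr_inr_inr {p q r m : ℕ} (i : Fin m) :
    (splitEquiv p q r m (inr (inr (inr i))) : ℕ) = p + (q + (r + i)) := by simp [splitEquiv]

/-- The index set of a seaweed split into three consecutive intervals. -/
def splitEquiv₃ (q r m : ℕ) : Fin q ⊕ (Fin r ⊕ Fin m) ≃ Fin (q + (r + m)) :=
  ((Equiv.refl _).sumCongr finSumFinEquiv).trans finSumFinEquiv

theorem splitEquiv_inr {p q r m : ℕ} (i : Fin q ⊕ (Fin r ⊕ Fin m)) :
    (splitEquiv p q r m (inr i) : ℕ) = p + splitEquiv₃ q r m i := by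
  rcases i with i | i | i <;> simp [splitEquiv, splitEquiv₃]

theorem splitEquiv₃_inl {q r m : ℕ} (i : Fin q) :
    (splitEquiv₃ q r m (inl i) : ℕ) = i := by simp [splitEquiv₃]

theorem splitEquiv₃_inr_inl {q r m : ℕ} (i : Fin r) :
    (splitEquiv₃ q r m (inr (inl i)) : ℕ) = q + i := by simp [splitEquiv₃]

theorem splitEquiv₃_inr_inr {q r m : ℕ} (i : Fin m) :
    (splitEquiv₃ q r m (inr (inr i)) : ℕ) = q + (r + i) := by simp [splitEquiv₃]

theorem frob_short_aux (x k m : ℕ) (a b : List ℕ) :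
    Frob (x + (k + (x + m))) (x :: a) ((x + k + x) :: b) ↔
      Frob (k + (x + m)) a (k :: x :: b) := by
  have h : ShortBlock
      (fun i j : Fin x ⊕ (Fin k ⊕ (Fin x ⊕ Fin m)) =>
        up (x :: a) (splitEquiv x k x m i) (splitEquiv x k x m j) ∧
        up ((x + k + x) :: b) (splitEquiv x k x m j) (splitEquiv x k x m i))
      (fun i j => up a (splitEquiv₃ k x m i) (splitEquiv₃ k x m j) ∧
        up (k :: x :: b) (splitEquiv₃ k x m j) (splitEquiv₃ k x m i)) :=
    { refl := fun i => ⟨up_refl _ _, up_refl _ _⟩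
      trans := fun i j k h1 h2 => ⟨up_trans _ h1.1 h2.1, up_trans _ h2.2 h1.2⟩
      ss := fun s t => ⟨up_cons_of_lt _ _ (by rw [splitEquiv_inl]; omega),
        up_cons_of_lt _ _ (by rw [splitEquiv_inl]; omega)⟩
      sk := fun s t => ⟨up_cons_of_lt _ _ (by rw [splitEquiv_inl]; omega),
        up_cons_of_lt _ _ (by rw [splitEquiv_inr_inl]; omega)⟩
      sj := fun s t => ⟨up_cons_of_lt _ _ (by rw [splitEquiv_inl]; omega),
        up_cons_of_lt _ _ (by rw [splitEquiv_inr_inr_inl]; omega)⟩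
      so := fun s o h => not_up_cons _ (by rw [splitEquiv_inr_inr_inr]; omega)
        (by rw [splitEquiv_inl]; omega) h.2
      rs := fun i s h => not_up_cons _ (by rw [splitEquiv_inr]; omega)
        (by rw [splitEquiv_inl]; omega) h.1
      kj := fun s t => ⟨up_of_le _ (by rw [splitEquiv_inr_inl, splitEquiv_inr_inr_inl]; omega),
        up_cons_of_lt _ _ (by rw [splitEquiv_inr_inr_inl]; omega)⟩
      ko := fun s o h => not_up_cons _ (by rw [splitEquiv_inr_inr_inr]; omega)
        (by rw [splitEquiv_inr_inl]; omega) h.2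
      jo := fun s o h => not_up_cons _ (by rw [splitEquiv_inr_inr_inr]; omega)
        (by rw [splitEquiv_inr_inr_inl]; omega) h.2
      -- Cutting the lower block into `k` and `x` forbids exactly the positions from κ to the third
      -- interval.
      q := fun i j => by
        rw [splitEquiv_inr, splitEquiv_inr, up_cons_add, and_assoc]
        refine and_congr_right fun _ => ?_
        have e : ∀ v, x + v - (x + k + x) = v - k - x := fun v => by omega
        simp only [up, e]
        rcases i with i | i | i <;> rcases j with j | j | j <;>
          simp only [splitEquiv₃_inl, splitEquiv₃_inr_inl, splitEquiv₃_inr_inr, inl.injEq,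
            inr.injEq, reduceCtorEq, exists_false, exists_eq', and_true, and_false,
            not_false_eq_true, not_true_eq_false, iff_false] <;>
          have hi := i.2 <;> have hj := j.2 <;> grind }
  refine Iff.trans ?_ (h.frobRel_iff.trans ?_)
  · exact (frobRel_congr (splitEquiv x k x m) fun i j => Iff.rfl).symm
  · exact frobRel_congr (splitEquiv₃ k x m) fun i j => Iff.rfl

theorem frob_long_aux (p q m : ℕ) (a b : List ℕ) :
    Frob (p + (q + (p + m))) ((p + q) :: a) ((p + q + p) :: b) ↔
      Frob (q + (p + m)) (q :: a) ((q + p) :: b) := by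
  have h : LongBlock
      (fun i j : Fin p ⊕ (Fin q ⊕ (Fin p ⊕ Fin m)) =>
        up ((p + q) :: a) (splitEquiv p q p m i) (splitEquiv p q p m j) ∧
        up ((p + q + p) :: b) (splitEquiv p q p m j) (splitEquiv p q p m i)) := by
    constructor <;> intros
    · exact ⟨up_refl _ _, up_refl _ _⟩
    · rename_i h1 h2
      exact ⟨up_trans _ h1.1 h2.1, up_trans _ h2.2 h1.2⟩
    iterate 6
      refine ⟨?_, ?_⟩ <;>
      · apply up_cons_of_lt
        simp only [splitEquiv_inl, splitEquiv_inr_inl, splitEquiv_inr_inr_inl]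
        omega
    iterate 3
      rintro ⟨-, h⟩
      refine not_up_cons _ ?_ ?_ h <;>
      · simp only [splitEquiv_inl, splitEquiv_inr_inl, splitEquiv_inr_inr_inl,
          splitEquiv_inr_inr_inr]
        omega
    iterate 2
      rintro ⟨h, -⟩
      rename_i i _
      refine not_up_cons _ ?_ ?_ h <;> rcases i with i | i <;>
      · simp only [splitEquiv_inl, splitEquiv_inr_inl, splitEquiv_inr_inr_inl,
          splitEquiv_inr_inr_inr]
        omega
  refine Iff.trans ?_ (h.frobRel_iff.trans ?_)
  · exact (frobRel_congr (splitEquiv p q p m) fun i j => Iff.rfl).symm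
  · refine frobRel_congr (splitEquiv₃ q p m) fun i j => ?_
    have e1 : ∀ v, p + v - (p + q) = v - q := fun v => by omega
    have e2 : ∀ v, p + v - (p + (q + p)) = v - (q + p) := fun v => by omega
    simp only [splitEquiv_inr, up, e1, e2, add_assoc, Nat.add_le_add_iff_left]

theorem frob_short {n x y : ℕ} {a b : List ℕ} (h : 2 * x ≤ y) (hy : y ≤ n) :
    Frob n (x :: a) (y :: b) ↔ Frob (n - x) a ((y - 2 * x) :: x :: b) := by
  have := frob_short_aux x (y - 2 * x) (n - y) a b
  rwa [show x + (y - 2 * x + (x + (n - y))) = n by omega, show x + (y - 2 * x) + x = y by omega,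
    show y - 2 * x + (x + (n - y)) = n - x by omega] at this

theorem frob_long {n x y : ℕ} {a b : List ℕ} (h₁ : x ≤ y) (h₂ : y ≤ 2 * x) (hy : y ≤ n) :
    Frob n (x :: a) (y :: b) ↔ Frob (n - (y - x)) ((2 * x - y) :: a) (x :: b) := by
  have := frob_long_aux (y - x) (2 * x - y) (n - y) a b
  rwa [show y - x + (2 * x - y + (y - x + (n - y))) = n by omega,
    show y - x + (2 * x - y) = x by omega, show x + (y - x) = y by omega,
    show 2 * x - y + (y - x + (n - y)) = n - (y - x) by omega,
    show 2 * x - y + (y - x) = x by omega] at this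

/-- A seaweed that splits as a direct product is not Frobenius. -/
theorem not_frob_of_prefix {n : ℕ} (a₁ b₁ : List ℕ) {a b : List ℕ} (h : a₁.sum = b₁.sum)
    (h0 : 0 < a₁.sum) (hn : a₁.sum < n) : ¬ Frob n (a₁ ++ a) (b₁ ++ b) := by
  rintro ⟨f, hf⟩
  have hiff : ∀ i j : Fin n, up (a₁ ++ a) i j ∧ up (b₁ ++ b) j i →
      ((i : ℕ) < a₁.sum ↔ (j : ℕ) < a₁.sum) := by
    rintro i j ⟨h1, h2⟩
    have h1 := (up_iff _ _ _).1 h1 a₁.length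
    have h2 := (up_iff _ _ _).1 h2 b₁.length
    rw [List.take_left] at h1 h2
    omega
  -- No allowed position joins the first `a₁.sum` coordinates to the others, so the projection onto
  -- them is a nonscalar centralizer of every form.
  obtain ⟨c, hc⟩ := hf (Matrix.diagonal fun i : Fin n => if (i : ℕ) < a₁.sum then 1 else 0)
    ⟨fun i j hij => by
      have : i = j := by
        by_contra hne
        exact hij (Matrix.diagonal_apply_ne _ hne)
      subst this
      exact ⟨up_refl _ _, up_refl _ _⟩, fun i j hij => by
      rw [Matrix.diagonal_mul, Matrix.mul_diagonal]
      simp only [hiff i j hij]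
      ring⟩
  have e1 := congrFun (congrFun hc ⟨0, by omega⟩) ⟨0, by omega⟩
  have e2 := congrFun (congrFun hc ⟨a₁.sum, hn⟩) ⟨a₁.sum, hn⟩
  simp [h0] at e1 e2
  rw [← e1] at e2
  exact zero_ne_one e2

/-- The special linear Lie algebra is not Frobenius. -/
theorem not_frob_single {n : ℕ} (hn : 2 ≤ n) : ¬ Frob n [n] [n] := by
  rintro ⟨f, hf⟩
  have hP : ∀ i j : Fin n, up [n] i j ∧ up [n] j i :=
    fun i j => ⟨up_cons_of_lt _ _ i.2, up_cons_of_lt _ _ j.2⟩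
  -- Every position is allowed, so `f` centralizes itself and must be scalar; then a nonscalar
  -- elementary matrix centralizes it too.
  obtain ⟨c, hc⟩ := hf f ⟨fun i j _ => hP j i, fun i j _ => rfl⟩
  obtain ⟨d, hd⟩ := hf (Matrix.single ⟨0, by omega⟩ ⟨1, by omega⟩ 1)
    ⟨fun i j _ => hP j i, fun i j _ => by rw [hc]; simp⟩
  have := congrFun (congrFun hd ⟨0, by omega⟩) ⟨1, by omega⟩
  simp at this

theorem frob_one {a b : List ℕ} : Frob 1 a b := by
  refine ⟨0, fun y _ => ⟨y 0 0, ?_⟩⟩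
  ext i j
  rw [Subsingleton.elim i 0, Subsingleton.elim j 0]
  simp

/-- Each short move leaves the shrinking remainder of `y` in front and deposits the removed block
right behind it, hence the reversal of `L`. -/
theorem frob_fold_left : ∀ (L : List ℕ) {n y : ℕ} {a b : List ℕ}, 2 * L.sum ≤ y → y ≤ n →
    (Frob n (L ++ a) (y :: b) ↔
      Frob (n - L.sum) a ((y - 2 * L.sum) :: (L.reverse ++ b)))
  | [], n, y, a, b, _, _ => by simp
  | x :: L, n, y, a, b, h, hy => by
    rw [List.sum_cons] at h
    rw [List.cons_append, frob_short (by omega) hy, frob_fold_left L (by omega) (by omega)]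
    simp only [List.sum_cons, List.reverse_cons, List.append_assoc, List.singleton_append]
    rw [show n - x - L.sum = n - (x + L.sum) by omega,
      show y - 2 * x - 2 * L.sum = y - 2 * (x + L.sum) by omega]

/-- Folding the parabolic seaweed of `L ++ M ++ R` along its lower arcs. -/
theorem frob_fold (L M R : List ℕ) {n : ℕ} (hs : (L ++ M ++ R).sum = n) (h : 2 * L.sum ≤ n) :
    Frob n (L ++ M ++ R) [n] ↔
      Frob (n - L.sum) (R.reverse ++ M.reverse) (L ++ [n - 2 * L.sum]) := by
  simp only [List.sum_append] at hs
  rw [List.append_assoc, frob_fold_left L h le_rfl, frob_reverse]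
  · simp
  · simp only [List.sum_append]; omega
  · simp only [List.sum_cons, List.sum_append, List.sum_reverse, List.sum_nil]; omega

end Seaweed

/-! ### From the Lie algebra index to the centralizer condition. -/

namespace Seaweed

attribute [local instance] LieRing.ofAssociativeRing

theorem mem_span_single_iff {n : ℕ} (S : Fin n → Prop) (v : Fin n → ℂ) :
    v ∈ Submodule.span ℂ {w : Fin n → ℂ | ∃ k : Fin n, S k ∧ w = Pi.single k 1} ↔
      ∀ k, ¬ S k → v k = 0 := by
  classical
  constructor
  · intro h k hk
    induction h using Submodule.span_induction with
    | mem x hx =>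
      obtain ⟨l, hl, rfl⟩ := hx
      have : k ≠ l := by rintro rfl; exact hk hl
      simp [this]
    | zero => rfl
    | add x y _ _ hx hy => simp [hx, hy]
    | smul c x _ hx => simp [hx]
  · intro h
    rw [← Finset.univ_sum_single v]
    refine Submodule.sum_mem _ fun k _ => ?_
    by_cases hk : S k
    · have : (Pi.single k (v k) : Fin n → ℂ) = v k • Pi.single k 1 := by
        rw [← Pi.single_smul]; simp
      rw [this]
      exact Submodule.smul_mem _ _ (Submodule.subset_span ⟨k, hk, rfl⟩)
    · rw [h k hk]; simp

theorem mem_preserving_span_iff {n : ℕ} (S : Fin n → Prop) (A : Matrix (Fin n) (Fin n) ℂ) :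
    A ∈ preserving (Submodule.span ℂ {w : Fin n → ℂ | ∃ k : Fin n, S k ∧ w = Pi.single k 1}) ↔
      ∀ i j, A i j ≠ 0 → S j → S i := by
  change (∀ v ∈ _, _) ↔ _
  constructor
  · intro h i j hij hj
    by_contra hi
    have := (mem_span_single_iff S _).1
      (h (Pi.single j 1) (Submodule.subset_span ⟨j, hj, rfl⟩)) i hi
    rw [Matrix.mulVec_single_one] at this
    exact hij this
  · intro h v hv
    rw [mem_span_single_iff] at hv ⊢
    intro i hi
    rw [Matrix.mulVec, dotProduct]
    refine Finset.sum_eq_zero fun j _ => ?_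
    by_cases hj : S j
    · rw [by_contra fun h0 => hi (h i j h0 hj), zero_mul]
    · rw [hv j hj, mul_zero]

theorem lieSubalgebra_mem_iInf {ι R L : Type*} [CommRing R] [LieRing L] [LieAlgebra R L]
    (S : ι → LieSubalgebra R L) (x : L) : x ∈ ⨅ i, S i ↔ ∀ i, x ∈ S i := by
  rw [iInf, ← SetLike.mem_coe, LieSubalgebra.coe_sInf]
  simp

theorem mem_seaweed_iff {n : ℕ} (a b : Composition n) (A : Matrix (Fin n) (Fin n) ℂ) :
    A ∈ seaweed a b ↔ A.trace = 0 ∧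
      ∀ i j, A i j ≠ 0 → up a.blocks i j ∧ up b.blocks j i := by
  have h1 : A ∈ seaweed a b ↔ A.trace = 0 ∧ ((∀ i, A ∈ preserving (flagUp a i)) ∧
      ∀ j, A ∈ preserving (flagDown b j)) := by
    rw [seaweed, LieSubalgebra.mem_inf, LieSubalgebra.mem_inf, lieSubalgebra_mem_iInf,
      lieSubalgebra_mem_iInf]
    rfl
  rw [h1]
  refine and_congr_right fun _ => ?_
  simp only [flagUp, flagDown, mem_preserving_span_iff, up_iff, Composition.sizeUpTo]
  constructor
  · rintro ⟨h1, h2⟩ i j hij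
    refine ⟨fun k hk => ?_, fun k hk => h2 k i j hij hk⟩
    by_contra h
    have := h1 k i j hij (by omega)
    omega
  · intro h
    refine ⟨fun k i j hij hj => ?_, fun k i j hij hj => (h i j hij).2 k hj⟩
    by_contra hi
    have := (h i j hij).1 k (by omega)
    omega

/-- Cyclicity of the trace exposes the coefficient of each `z i j`: it is the commutation defect of
the transpose of `x` at that position. -/
theorem trace_transpose_mul_lie {n : ℕ} (f x z : Matrix (Fin n) (Fin n) ℂ) :
    (f.transpose * (x * z - z * x)).trace =
      ∑ i, ∑ j, z i j * ((x.transpose * f) i j - (f * x.transpose) i j) := by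
  have e1 : (f.transpose * (x * z - z * x)).trace =
      (z * (f.transpose * x - x * f.transpose)).trace := by
    rw [mul_sub, mul_sub, Matrix.trace_sub, Matrix.trace_sub, ← mul_assoc, Matrix.trace_mul_comm,
      ← mul_assoc, ← mul_assoc, Matrix.trace_mul_cycle f.transpose z x]
    rw [Matrix.trace_mul_comm (x * f.transpose) z, mul_assoc]
  rw [e1, Matrix.trace]
  refine Finset.sum_congr rfl fun i _ => ?_
  rw [Matrix.diag_apply, Matrix.mul_apply]
  refine Finset.sum_congr rfl fun j _ => ?_
  congr 1
  have e2 : f.transpose * x - x * f.transpose = (x.transpose * f - f * x.transpose).transpose := by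
    simp [Matrix.transpose_sub, Matrix.transpose_mul]
  rw [e2, Matrix.transpose_apply, Matrix.sub_apply]

theorem lieIndex_eq_zero_iff {K L : Type*} [Field K] [LieRing L] [LieAlgebra K L]
    [FiniteDimensional K L] :
    lieIndex K L = 0 ↔ ∃ f : Module.Dual K L, ∀ x : L, (∀ y : L, f ⁅x, y⁆ = 0) → x = 0 := by
  have h1 : lieIndex K L = 0 ↔ ∃ f : Module.Dual K L,
      Module.finrank K (LinearMap.ker (kirillovForm f)) = 0 := by
    constructor
    · intro h
      obtain ⟨f, hf⟩ := Nat.sInf_mem (Set.range_nonempty fun f : Module.Dual K L =>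
        Module.finrank K (LinearMap.ker (kirillovForm f)))
      exact ⟨f, hf.trans h⟩
    · rintro ⟨f, hf⟩
      exact Nat.eq_zero_of_le_zero ((ciInf_le (OrderBot.bddBelow _) f).trans hf.le)
  rw [h1]
  refine exists_congr fun f => ?_
  rw [Submodule.finrank_eq_zero, LinearMap.ker_eq_bot']
  refine forall_congr' fun x => imp_congr_left ?_
  rw [LinearMap.ext_iff]
  rfl

theorem lieIndex_seaweed_eq_zero_iff {n : ℕ} (hn : 0 < n) (a b : Composition n) :
    lieIndex ℂ (seaweed a b) = 0 ↔ Frob n a.blocks b.blocks := by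
  have hn' : (n : ℂ) ≠ 0 := by exact_mod_cast hn.ne'
  rw [lieIndex_eq_zero_iff]
  constructor
  · rintro ⟨φ, hφ⟩
    obtain ⟨ψ, hψ⟩ := LinearMap.exists_extend (p := (seaweed a b).toSubmodule) φ
    let f : Matrix (Fin n) (Fin n) ℂ := fun i j => ψ (Matrix.single i j 1)
    have hf : ∀ A : Matrix (Fin n) (Fin n) ℂ, ψ A = (f.transpose * A).trace := by
      intro A
      conv_lhs => rw [Matrix.matrix_eq_sum_single A]
      simp only [map_sum, Matrix.trace, Matrix.diag_apply, Matrix.mul_apply,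
        Matrix.transpose_apply]
      rw [Finset.sum_comm]
      refine Finset.sum_congr rfl fun j _ => Finset.sum_congr rfl fun i _ => ?_
      have : Matrix.single i j (A i j) = A i j • Matrix.single i j (1 : ℂ) := by
        rw [Matrix.smul_single, smul_eq_mul, mul_one]
      rw [this, map_smul, smul_eq_mul, mul_comm]
    refine ⟨f, fun y hy => ?_⟩
    let c : ℂ := y.trace / n
    -- Removing the trace part puts the matrix in the seaweed without changing its commutators.
    let x : Matrix (Fin n) (Fin n) ℂ := y.transpose - c • 1
    have hx : x ∈ seaweed a b := by
      rw [mem_seaweed_iff]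
      refine ⟨by simp [x, c, Matrix.trace_sub, hn'], fun i j hij => ?_⟩
      by_cases h : i = j
      · subst h; exact ⟨up_refl _ _, up_refl _ _⟩
      · refine hy.1 j i ?_
        simpa [x, h] using hij
    have h0 := hφ ⟨x, hx⟩ fun z => by
      have e1 : φ ⁅(⟨x, hx⟩ : seaweed a b), z⁆ = ψ (x * z.1 - z.1 * x) := by
        rw [← hψ]; rfl
      have e2 : x * z.1 - z.1 * x = y.transpose * z.1 - z.1 * y.transpose := by
        simp [x, sub_mul, mul_sub]
      rw [e1, hf, e2, trace_transpose_mul_lie]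
      refine Finset.sum_eq_zero fun i _ => Finset.sum_eq_zero fun j _ => ?_
      by_cases hz : z.1 i j = 0
      · rw [hz, zero_mul]
      · have := hy.2 i j (((mem_seaweed_iff a b z.1).1 z.2).2 i j hz)
        rw [Matrix.transpose_transpose, this, sub_self, mul_zero]
    have h1 : x = 0 := congrArg Subtype.val h0
    refine ⟨c, ?_⟩
    have h2 : y.transpose = c • 1 := sub_eq_zero.1 h1
    rw [← Matrix.transpose_transpose y, h2]
    simp
  · rintro ⟨f, hf⟩
    let ψ : Matrix (Fin n) (Fin n) ℂ →ₗ[ℂ] ℂ :=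
      (Matrix.traceLinearMap (Fin n) ℂ ℂ).comp (LinearMap.mulLeft ℂ f.transpose)
    refine ⟨ψ.comp (seaweed a b).toSubmodule.subtype, fun x hx => ?_⟩
    obtain ⟨hx1, hx2⟩ := (mem_seaweed_iff a b x.1).1 x.2
    obtain ⟨c, hc⟩ := hf x.1.transpose ⟨fun i j hij => hx2 j i hij, fun i j hij => by
      -- Testing against an elementary matrix, corrected by a scalar to have trace zero, isolates
      -- the equation at position `(i, j)`.
      let z : Matrix (Fin n) (Fin n) ℂ :=
        Matrix.single i j 1 - ((Matrix.single i j (1 : ℂ)).trace / n) • 1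
      have hz : z ∈ seaweed a b := by
        rw [mem_seaweed_iff]
        refine ⟨by simp [z, Matrix.trace_sub, hn'], fun k l hkl => ?_⟩
        by_cases h : k = l
        · subst h; exact ⟨up_refl _ _, up_refl _ _⟩
        · have : Matrix.single i j (1 : ℂ) k l ≠ 0 := by simpa [z, h] using hkl
          rw [Matrix.single_apply] at this
          obtain ⟨rfl, rfl⟩ : i = k ∧ j = l := by
            by_contra h'
            exact this (if_neg h')
          exact hij
      have h1 : (f.transpose * (x.1 * z - z * x.1)).trace = 0 := hx ⟨z, hz⟩
      have e2 : x.1 * z - z * x.1 = x.1 * Matrix.single i j 1 - Matrix.single i j 1 * x.1 := by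
        simp [z, sub_mul, mul_sub]
      rw [e2, trace_transpose_mul_lie, Finset.sum_eq_single i, Finset.sum_eq_single j] at h1
      · simpa [sub_eq_zero] using h1
      · intro l _ hl
        simp [hl.symm]
      · simp
      · intro k _ hk
        simp [hk.symm]
      · simp⟩
    have hc' : x.1 = c • 1 := by
      rw [← Matrix.transpose_transpose x.1, hc]; simp
    rw [hc', Matrix.trace_smul, Matrix.trace_one, Fintype.card_fin, smul_eq_mul] at hx1
    have : c = 0 := (mul_eq_zero.1 hx1).resolve_right hn'
    apply Subtype.ext
    rw [hc', this]
    simp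

theorem isFrobenius_iff {n : ℕ} (hn : 0 < n) (p : n.Partition) :
    IsFrobenius p ↔ Frob n (p.parts.sort (· ≥ ·)) [n] := by
  rw [IsFrobenius, pairIndex, lieIndex_seaweed_eq_zero_iff hn]
  simp [toComposition, hn.ne']

end Seaweed

namespace Seaweed

/-! ### Local obstructions. -/

section Local

variable {N : ℕ} {t u : List ℕ}

/-- The moves alter only leading blocks, so the tails are arbitrary: here one move already produces
equal prefixes. The other patterns of this section reduce to equal prefixes in the same way. -/
theorem not_frob_1_2_4 (hN : 4 ≤ N) : ¬ Frob N (1 :: 2 :: t) (4 :: u) := by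
  rw [frob_short (by norm_num) hN]
  exact not_frob_of_prefix [2] [2] rfl (by simp) (by simp; omega)

theorem not_frob_1_1_1_4 (hN : 4 ≤ N) : ¬ Frob N (1 :: 1 :: 1 :: t) (4 :: u) := by
  rw [frob_short (by norm_num) hN, frob_short (by norm_num) (by omega)]
  exact not_frob_of_prefix [1] [0, 1] rfl (by simp) (by simp; omega)

theorem not_frob_1_1_3 (hN : 3 ≤ N) : ¬ Frob N (1 :: 1 :: t) (3 :: u) := by
  rw [frob_short (by norm_num) hN]
  exact not_frob_of_prefix [1] [1] rfl (by simp) (by simp; omega)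

theorem not_frob_1_3_3 (hN : 4 ≤ N) : ¬ Frob N (1 :: 3 :: t) (3 :: u) := by
  rw [frob_short (by norm_num) (by omega), frob_swap]
  exact not_frob_1_1_3 (by omega)

theorem not_frob_1_1_3_4 (hN : 5 ≤ N) : ¬ Frob N (1 :: 1 :: 3 :: t) (4 :: u) := by
  rw [frob_short (by norm_num) (by omega), frob_short (by norm_num) (by omega), frob_swap,
    frob_zero_left]
  exact not_frob_1_1_3 (by omega)

theorem not_frob_1_3_2_3 (hN : 5 ≤ N) : ¬ Frob N (1 :: 3 :: t) (2 :: 3 :: u) := by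
  rw [frob_short (by norm_num) (by omega), frob_swap, frob_zero_left]
  exact not_frob_1_3_3 (by omega)

theorem not_frob_2_3_3_3 (hN : 6 ≤ N) : ¬ Frob N (2 :: 3 :: t) (3 :: 3 :: u) := by
  rw [frob_long (by norm_num) (by norm_num) (by omega)]
  exact not_frob_1_3_2_3 (by omega)

theorem not_frob_3_3_4_3 (hN : 7 ≤ N) : ¬ Frob N (3 :: 3 :: t) (4 :: 3 :: u) := by
  rw [frob_long (by norm_num) (by norm_num) (by omega)]
  exact not_frob_2_3_3_3 (by omega)

theorem not_frob_2_2_3_3_3 (hN : 7 ≤ N) : ¬ Frob N (2 :: 2 :: 3 :: t) (3 :: 3 :: u) := by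
  rw [frob_long (by norm_num) (by norm_num) (by omega), frob_short (by norm_num) (by omega),
    frob_swap, frob_zero_left]
  exact not_frob_1_3_2_3 (by omega)

theorem not_frob_2_3_3_4_3 (hN : 8 ≤ N) : ¬ Frob N (2 :: 3 :: 3 :: t) (4 :: 3 :: u) := by
  rw [frob_short (by norm_num) (by omega), frob_swap, frob_zero_left]
  exact not_frob_2_3_3_3 (by omega)

theorem not_frob_3_3_3_4_4 (hN : 9 ≤ N) : ¬ Frob N (3 :: 3 :: 3 :: t) (4 :: 4 :: u) := by
  rw [frob_long (by norm_num) (by norm_num) (by omega),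
    frob_long (by norm_num) (by norm_num) (by omega), frob_short (by norm_num) (by omega),
    frob_swap, frob_zero_left, frob_short (by norm_num) (by omega), frob_swap]
  exact not_frob_1_1_3_4 (by omega)

end Local

/-! ### Infinite families by descent. -/

section Families

/-- The folded form of the seaweed `R ++ [4, …, 4] / n`. -/
theorem frob_append_four (R : List ℕ) {n k : ℕ} (hn : R.sum + 4 * k = n) (hR : R.sum ≤ 4 * k) :
    Frob n (R ++ List.replicate k 4) [n] ↔
      Frob (4 * k) (R ++ [4 * k - R.sum]) (List.replicate k 4) := by
  have := frob_fold R (List.replicate k 4) [] (n := n) (by simp; omega) (by omega)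
  rw [List.append_nil] at this
  rw [this, frob_swap, show n - R.sum = 4 * k by omega, show n - 2 * R.sum = 4 * k - R.sum by omega]
  simp

/-- Absorbing a leading 4 and folding again exchanges the prefixes 1 and 2|1, so the two claims are
proved together. -/
theorem frob_four_one_aux : ∀ k,
    Frob (4 * (k + 1)) [1, 4 * (k + 1) - 1] (List.replicate (k + 1) 4) ∧
    Frob (4 * (k + 1)) [2, 1, 4 * (k + 1) - 3] (List.replicate (k + 1) 4)
  | 0 => by
    constructor
    · rw [List.replicate_succ, frob_short (by norm_num) (by omega), frob_swap,
        frob_long (by norm_num) (by norm_num) (by omega), frob_short (by norm_num) (by omega)]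
      exact frob_one
    · rw [List.replicate_succ, frob_short (by norm_num) (by omega), frob_zero_right,
        frob_short (by norm_num) (by omega)]
      exact frob_one
  | k + 1 => by
    obtain ⟨h1, h2⟩ := frob_four_one_aux k
    constructor
    · rw [List.replicate_succ, frob_short (by norm_num) (by omega), frob_swap]
      exact (frob_append_four [2, 1] (by simp; omega) (by simp; omega)).2 h2
    · rw [List.replicate_succ, frob_short (by norm_num) (by omega), frob_zero_right,
        frob_short (by norm_num) (by omega), frob_zero_right, frob_swap]
      exact (frob_append_four [1] (by simp; omega) (by simp; omega)).2 h1

theorem frob_four_one_one_aux :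
    ∀ k, Frob (4 * (k + 1)) [1, 1, 4 * (k + 1) - 2] (List.replicate (k + 1) 4)
  | 0 => by
    rw [List.replicate_succ, frob_short (by norm_num) (by omega),
      frob_short (by norm_num) (by omega), frob_zero_right, frob_swap,
      frob_short (by norm_num) (by omega)]
    exact frob_one
  | k + 1 => by
    rw [List.replicate_succ, frob_short (by norm_num) (by omega),
      frob_short (by norm_num) (by omega), frob_zero_right, frob_swap]
    exact (frob_append_four [1, 1] (by simp; omega) (by simp; omega)).2 (frob_four_one_one_aux k)

/-- Each absorbed 4 reproduces the prefix 2, and the descent ends at sl_2. -/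
theorem not_frob_four_two_aux :
    ∀ k, ¬ Frob (4 * (k + 1)) [2, 4 * (k + 1) - 2] (List.replicate (k + 1) 4)
  | 0 => by
    rw [List.replicate_succ, frob_short (by norm_num) (by omega), frob_zero_right]
    exact not_frob_single le_rfl
  | k + 1 => by
    rw [List.replicate_succ, frob_short (by norm_num) (by omega), frob_zero_right, frob_swap]
    intro h
    exact not_frob_four_two_aux k
      ((frob_append_four [2] (by simp; omega) (by simp; omega)).1 h)

/-- Non-increasing lists with entries at most `4`. -/
def partList (i j k l : ℕ) : List ℕ :=
  List.replicate i 4 ++ (List.replicate j 3 ++ (List.replicate k 2 ++ List.replicate l 1))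

theorem sum_partList (i j k l : ℕ) : (partList i j k l).sum = 4 * i + 3 * j + 2 * k + l := by
  simp [partList]; ring

theorem reverse_partList (i j k l : ℕ) : (partList i j k l).reverse =
    List.replicate l 1 ++ (List.replicate k 2 ++ (List.replicate j 3 ++ List.replicate i 4)) := by
  simp [partList]

/-- The partition with the given multiplicities of `4`, `3`, `2`, `1` is Frobenius. -/
def PartFrob (i j k l : ℕ) : Prop :=
  Frob (4 * i + 3 * j + 2 * k + l) (partList i j k l) [4 * i + 3 * j + 2 * k + l]

theorem partFrob_iff_reverse (i j k l : ℕ) : PartFrob i j k l ↔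
    Frob (4 * i + 3 * j + 2 * k + l) (partList i j k l).reverse [4 * i + 3 * j + 2 * k + l] := by
  rw [PartFrob, frob_reverse (sum_partList i j k l) (by simp)]
  simp

theorem partFrob_four_one (k : ℕ) : PartFrob (k + 1) 0 0 1 := by
  rw [partFrob_iff_reverse, reverse_partList]
  exact (frob_append_four [1] (by simp; omega) (by simp; omega)).2 (frob_four_one_aux k).1

theorem partFrob_four_one_one (k : ℕ) : PartFrob (k + 1) 0 0 2 := by
  rw [partFrob_iff_reverse, reverse_partList]
  exact (frob_append_four [1, 1] (by simp; omega) (by simp; omega)).2 (frob_four_one_one_aux k)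

theorem not_partFrob_four_two (k : ℕ) : ¬ PartFrob (k + 1) 0 1 0 := by
  rw [partFrob_iff_reverse, reverse_partList]
  intro h
  exact not_frob_four_two_aux k ((frob_append_four [2] (by simp; omega) (by simp; omega)).1 h)

/-- Three moves absorb one 4 and turn the 3 into a 1. -/
theorem partFrob_four_three (k : ℕ) : PartFrob (k + 2) 1 0 0 := by
  rw [partFrob_iff_reverse, reverse_partList]
  refine (frob_append_four [3] (by simp; omega) (by simp; omega)).2 ?_
  rw [List.replicate_succ]
  change Frob _ [3, 4 * (k + 2) - 3] _
  rw [frob_long (by norm_num) (by norm_num) (by omega),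
    frob_long (by norm_num) (by norm_num) (by omega), frob_short (by norm_num) (by omega),
    frob_zero_right, frob_swap]
  exact (frob_append_four [1] (by simp; omega) (by simp; omega)).2 (frob_four_one_aux k).1

/-- The moves absorb two 4s and turn the prefix 3|3 into 1|1. -/
theorem partFrob_four_three_three (k : ℕ) : PartFrob (k + 3) 2 0 0 := by
  rw [partFrob_iff_reverse, reverse_partList]
  refine (frob_append_four [3, 3] (by simp; omega) (by simp; omega)).2 ?_
  rw [List.replicate_succ, List.replicate_succ]
  change Frob _ [3, 3, 4 * (k + 3) - 6] _
  rw [frob_long (by norm_num) (by norm_num) (by omega),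
    frob_long (by norm_num) (by norm_num) (by omega), frob_short (by norm_num) (by omega),
    frob_zero_right, frob_swap, frob_short (by norm_num) (by omega), frob_swap,
    frob_short (by norm_num) (by omega), frob_short (by norm_num) (by omega),
    frob_zero_right, frob_swap]
  exact (frob_append_four [1, 1] (by simp; omega) (by simp; omega)).2 (frob_four_one_one_aux k)

/-- The moves absorb one 4 and land directly on the folded form of 4^(k+1) 1. -/
theorem partFrob_four_three_two (k : ℕ) : PartFrob (k + 2) 1 1 0 := by
  rw [partFrob_iff_reverse, reverse_partList]
  refine (frob_append_four [2, 3] (by simp; omega) (by simp; omega)).2 ?_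
  rw [List.replicate_succ]
  change Frob _ [2, 3, 4 * (k + 2) - 5] _
  rw [frob_short (by norm_num) (by omega), frob_zero_right, frob_swap,
    frob_long (by norm_num) (by norm_num) (by omega), frob_short (by norm_num) (by omega),
    frob_zero_right, frob_swap]
  convert (frob_four_one_aux k).1 using 1
  · omega
  · rw [show 4 * (k + 2) - 5 = 4 * (k + 1) - 1 by omega]

theorem frob_two_one_aux : ∀ k, Frob (2 * (k + 1)) [1, 2 * (k + 1) - 1] (List.replicate (k + 1) 2)
  | 0 => by
    rw [List.replicate_succ, frob_short (by norm_num) (by omega)]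
    exact frob_one
  | k + 1 => by
    rw [List.replicate_succ, frob_short (by norm_num) (by omega), frob_zero_right, frob_swap]
    have := frob_fold [1] (List.replicate (k + 1) 2) [] (n := 2 * (k + 1 + 1) - 1)
      (by simp; omega) (by simp; omega)
    rw [List.append_nil] at this
    refine this.2 (frob_swap.1 ?_)
    convert frob_two_one_aux k using 1
    · simp; omega
    · simp; omega
    · simp

theorem partFrob_two_one (k : ℕ) : PartFrob 0 0 (k + 1) 1 := by
  rw [partFrob_iff_reverse, reverse_partList]
  have := frob_fold [1] (List.replicate (k + 1) 2) [] (n := 4 * 0 + 3 * 0 + 2 * (k + 1) + 1)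
    (by simp; omega) (by simp; omega)
  rw [List.append_nil] at this
  simp only [List.replicate_zero, List.append_nil]
  refine this.2 (frob_swap.1 ?_)
  convert frob_two_one_aux k using 1
  · simp
  · simp
  · simp

/-- Folding along the 3 and absorbing one 2 gives the folded form of 2^(k+1) 1. -/
theorem partFrob_three_two (k : ℕ) : PartFrob 0 1 (k + 2) 0 := by
  have := frob_fold [3] (List.replicate (k + 2) 2) [] (n := 4 * 0 + 3 * 1 + 2 * (k + 2) + 0)
    (by simp; omega) (by simp; omega)
  rw [List.append_nil] at this
  have e : partList 0 1 (k + 2) 0 = [3] ++ List.replicate (k + 2) 2 := by simp [partList]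
  rw [PartFrob, e, this]
  simp only [List.reverse_nil, List.nil_append, List.reverse_replicate]
  rw [List.replicate_succ]
  change Frob _ _ [3, _]
  rw [frob_long (by norm_num) (by norm_num) (by simp; omega),
    frob_short (by norm_num) (by simp; omega), frob_zero_right, frob_swap]
  convert frob_two_one_aux k using 1
  · simp; omega
  · simp; omega

end Families

/-! ### Classification by multiplicities. -/

section Classification

theorem not_partFrob_of_local (L M R : List ℕ) {i j k l : ℕ} (h : partList i j k l = L ++ M ++ R)
    (h2 : 2 * L.sum ≤ 4 * i + 3 * j + 2 * k + l)
    (hl : ¬ Frob (4 * i + 3 * j + 2 * k + l - L.sum) (R.reverse ++ M.reverse)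
      (L ++ [4 * i + 3 * j + 2 * k + l - 2 * L.sum])) : ¬ PartFrob i j k l := by
  rw [PartFrob, h, frob_fold L M R (by rw [← h, sum_partList]) h2]
  exact hl

/-- After folding, `L` and the reversal of `R` are opposite prefixes of equal sum; the strict bound
makes them proper. -/
theorem not_partFrob_of_sum_eq (L M R : List ℕ) {i j k l : ℕ} (h : partList i j k l = L ++ M ++ R)
    (hs : R.sum = L.sum) (h0 : 0 < L.sum) (hM : 2 * L.sum < 4 * i + 3 * j + 2 * k + l) :
    ¬ PartFrob i j k l := by
  refine not_partFrob_of_local L M R h hM.le ?_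
  refine not_frob_of_prefix R.reverse L (by rw [List.sum_reverse, hs]) ?_ ?_
  · rw [List.sum_reverse, hs]; exact h0
  · rw [List.sum_reverse, hs]; omega

theorem not_partFrob_ones {l : ℕ} (hl : 3 ≤ l) : ¬ PartFrob 0 0 0 l := by
  obtain ⟨m, rfl⟩ : ∃ m, l = 1 + m + 1 := ⟨l - 2, by omega⟩
  refine not_partFrob_of_sum_eq [1] (List.replicate m 1) [1]
    (by simp only [partList, List.replicate_add, List.append_assoc]; rfl) rfl (by simp)
    (by simp; omega)

theorem partFrob_twos_iff {k l : ℕ} (h : 5 ≤ 2 * k + l) : PartFrob 0 0 k l ↔ l = 1 := by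
  rcases Nat.eq_zero_or_pos k with rfl | hk
  · have h1 : ¬ PartFrob 0 0 0 l := not_partFrob_ones (by omega)
    simp only [h1, false_iff]
    omega
  constructor
  · contrapose
    intro hl
    rcases Nat.eq_zero_or_pos l with rfl | hl'
    · obtain ⟨m, rfl⟩ : ∃ m, k = 1 + m + 1 := ⟨k - 2, by omega⟩
      refine not_partFrob_of_sum_eq [2] (List.replicate m 2) [2]
        (by simp only [partList, List.replicate_add, List.append_assoc]; rfl) rfl (by simp)
        (by simp; omega)
    · obtain ⟨m, rfl⟩ : ∃ m, k = 1 + m := ⟨k - 1, by omega⟩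
      obtain ⟨q, rfl⟩ : ∃ q, l = q + 2 := ⟨l - 2, by omega⟩
      refine not_partFrob_of_sum_eq [2] (List.replicate m 2 ++ List.replicate q 1) [1, 1]
        (by simp only [partList, List.replicate_add, List.append_assoc]; rfl) rfl (by simp)
        (by simp; omega)
  · rintro rfl
    obtain ⟨m, rfl⟩ : ∃ m, k = m + 1 := ⟨k - 1, by omega⟩
    exact partFrob_two_one m

theorem partFrob_threes_iff {j k l : ℕ} (hj : 0 < j) (h : 13 ≤ 3 * j + 2 * k + l) :
    PartFrob 0 j k l ↔ j = 1 ∧ l = 0 := by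
  constructor
  · contrapose
    intro hn
    -- The cases are sorted by the smallest parts, which decide what faces the leading 3 or 3|3
    -- after folding.
    rcases (by omega : 2 ≤ l ∨ l = 1 ∧ 0 < k ∨ l = 1 ∧ k = 0 ∨ l = 0 ∧ k = 0 ∨ l = 0 ∧ k = 1 ∨
      l = 0 ∧ k = 2 ∨ l = 0 ∧ 3 ≤ k) with
      hl | ⟨rfl, hk⟩ | ⟨rfl, rfl⟩ | ⟨rfl, rfl⟩ | ⟨rfl, rfl⟩ | ⟨rfl, rfl⟩ | ⟨rfl, hk⟩
    · obtain ⟨m, rfl⟩ : ∃ m, j = 1 + m := ⟨j - 1, by omega⟩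
      obtain ⟨q, rfl⟩ : ∃ q, l = q + 2 := ⟨l - 2, by omega⟩
      refine not_partFrob_of_local [3]
        (List.replicate m 3 ++ List.replicate k 2 ++ List.replicate q 1) [1, 1]
        (by simp only [partList, List.replicate_add, List.append_assoc]; rfl) (by simp; omega) ?_
      exact not_frob_1_1_3 (by simp; omega)
    · obtain ⟨m, rfl⟩ : ∃ m, j = 1 + m := ⟨j - 1, by omega⟩
      obtain ⟨q, rfl⟩ : ∃ q, k = q + 1 := ⟨k - 1, by omega⟩
      refine not_partFrob_of_sum_eq [3] (List.replicate m 3 ++ List.replicate q 2) [2, 1]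
        (by simp only [partList, List.replicate_add, List.append_assoc]; rfl) rfl (by simp)
        (by simp; omega)
    · obtain ⟨m, rfl⟩ : ∃ m, j = 1 + m + 1 := ⟨j - 2, by omega⟩
      refine not_partFrob_of_local [3] (List.replicate m 3) [3, 1]
        (by simp only [partList, List.replicate_add, List.append_assoc]; rfl) (by simp; omega) ?_
      exact not_frob_1_3_3 (by simp; omega)
    · obtain ⟨m, rfl⟩ : ∃ m, j = 1 + m + 1 := ⟨j - 2, by omega⟩
      refine not_partFrob_of_sum_eq [3] (List.replicate m 3) [3]
        (by simp only [partList, List.replicate_add, List.append_assoc]; rfl) rfl (by simp)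
        (by simp; omega)
    · obtain ⟨m, rfl⟩ : ∃ m, j = 2 + m + 1 := ⟨j - 3, by omega⟩
      refine not_partFrob_of_local [3, 3] (List.replicate m 3) [3, 2]
        (by simp only [partList, List.replicate_add, List.append_assoc]; rfl) (by simp; omega) ?_
      exact not_frob_2_3_3_3 (by simp; omega)
    · obtain ⟨m, rfl⟩ : ∃ m, j = 2 + m + 1 := ⟨j - 3, by omega⟩
      refine not_partFrob_of_local [3, 3] (List.replicate m 3) [3, 2, 2]
        (by simp only [partList, List.replicate_add, List.append_assoc]; rfl) (by simp; omega) ?_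
      exact not_frob_2_2_3_3_3 (by simp; omega)
    -- The split 3+3 = 2+2+2 needs 12 < n, which is where the bound 13 is sharp for the argument.
    · obtain ⟨m, rfl⟩ : ∃ m, j = 2 + m := ⟨j - 2, by omega⟩
      obtain ⟨q, rfl⟩ : ∃ q, k = q + 3 := ⟨k - 3, by omega⟩
      refine not_partFrob_of_sum_eq [3, 3] (List.replicate m 3 ++ List.replicate q 2) [2, 2, 2]
        (by simp only [partList, List.replicate_add, List.append_assoc]; rfl) rfl (by simp)
        (by simp; omega)
  · rintro ⟨rfl, rfl⟩
    obtain ⟨m, rfl⟩ : ∃ m, k = m + 2 := ⟨k - 2, by omega⟩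
    exact partFrob_three_two m

theorem partFrob_fours_iff {i j k l : ℕ} (hi : 0 < i) (h : 17 ≤ 4 * i + 3 * j + 2 * k + l) :
    PartFrob i j k l ↔ j = 0 ∧ k = 0 ∧ l = 1 ∨ j = 0 ∧ k = 0 ∧ l = 2 ∨ j = 1 ∧ k = 1 ∧ l = 0 ∨
      j = 1 ∧ k = 0 ∧ l = 0 ∨ j = 2 ∧ k = 0 ∧ l = 0 := by
  constructor
  · contrapose
    intro hn
    obtain ⟨i, rfl⟩ : ∃ m, i = 1 + m := ⟨i - 1, by omega⟩
    rcases (by omega : 3 ≤ l ∨ l = 2 ∨ l = 1 ∨ l = 0) with hl | rfl | rfl | rfl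
    · obtain ⟨q, rfl⟩ : ∃ q, l = q + 3 := ⟨l - 3, by omega⟩
      refine not_partFrob_of_local [4]
        (List.replicate i 4 ++ List.replicate j 3 ++ List.replicate k 2 ++ List.replicate q 1)
        [1, 1, 1]
        (by simp only [partList, List.replicate_add, List.append_assoc]; rfl) (by simp; omega) ?_
      exact not_frob_1_1_1_4 (by simp; omega)
    · rcases (by omega : 0 < k ∨ k = 0 ∧ 0 < j) with hk | ⟨rfl, hj⟩
      · obtain ⟨q, rfl⟩ : ∃ q, k = q + 1 := ⟨k - 1, by omega⟩
        refine not_partFrob_of_sum_eq [4]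
          (List.replicate i 4 ++ List.replicate j 3 ++ List.replicate q 2) [2, 1, 1]
          (by simp only [partList, List.replicate_add, List.append_assoc]; rfl) rfl (by simp)
          (by simp; omega)
      · obtain ⟨q, rfl⟩ : ∃ q, j = q + 1 := ⟨j - 1, by omega⟩
        refine not_partFrob_of_local [4] (List.replicate i 4 ++ List.replicate q 3) [3, 1, 1]
          (by simp only [partList, List.replicate_add, List.append_assoc]; rfl) (by simp; omega) ?_
        exact not_frob_1_1_3_4 (by simp; omega)
    · rcases (by omega : 0 < k ∨ k = 0 ∧ 0 < j) with hk | ⟨rfl, hj⟩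
      · obtain ⟨q, rfl⟩ : ∃ q, k = q + 1 := ⟨k - 1, by omega⟩
        refine not_partFrob_of_local [4]
          (List.replicate i 4 ++ List.replicate j 3 ++ List.replicate q 2) [2, 1]
          (by simp only [partList, List.replicate_add, List.append_assoc]; rfl) (by simp; omega) ?_
        exact not_frob_1_2_4 (by simp; omega)
      · obtain ⟨q, rfl⟩ : ∃ q, j = q + 1 := ⟨j - 1, by omega⟩
        refine not_partFrob_of_sum_eq [4] (List.replicate i 4 ++ List.replicate q 3) [3, 1]
          (by simp only [partList, List.replicate_add, List.append_assoc]; rfl) rfl (by simp)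
          (by simp; omega)
    -- Here `i` counts the 4s beyond the first, so `i = 0` means a single 4.
    · rcases (by omega : 2 ≤ k ∨ k = 1 ∧ j = 0 ∨ k = 1 ∧ 2 ≤ j ∧ i = 0 ∨ k = 1 ∧ 2 ≤ j ∧ 0 < i ∨
        k = 0 ∧ j = 0 ∨ k = 0 ∧ 3 ≤ j ∧ i = 0 ∨ k = 0 ∧ 3 ≤ j ∧ 0 < i) with
        hk | ⟨rfl, rfl⟩ | ⟨rfl, hj, rfl⟩ | ⟨rfl, hj, hi'⟩ | ⟨rfl, rfl⟩ | ⟨rfl, hj, rfl⟩ |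
        ⟨rfl, hj, hi'⟩
      · obtain ⟨q, rfl⟩ : ∃ q, k = q + 2 := ⟨k - 2, by omega⟩
        refine not_partFrob_of_sum_eq [4]
          (List.replicate i 4 ++ List.replicate j 3 ++ List.replicate q 2) [2, 2]
          (by simp only [partList, List.replicate_add, List.append_assoc]; rfl) rfl (by simp)
          (by simp; omega)
      -- The shape 4^(i+1) 2 is excluded by the descent to sl_2, not by a local pattern.
      · rw [add_comm]
        exact not_partFrob_four_two i
      · obtain ⟨q, rfl⟩ : ∃ q, j = 1 + q + 2 := ⟨j - 3, by omega⟩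
        refine not_partFrob_of_local [4, 3] (List.replicate q 3) [3, 3, 2]
          (by simp only [partList, List.replicate_add, List.append_assoc]; rfl) (by simp; omega) ?_
        exact not_frob_2_3_3_4_3 (by simp; omega)
      -- The split 4+4 = 3+3+2 needs 16 < n, hence the bound 17.
      · obtain ⟨m, rfl⟩ : ∃ m, i = 1 + m := ⟨i - 1, by omega⟩
        obtain ⟨q, rfl⟩ : ∃ q, j = q + 2 := ⟨j - 2, by omega⟩
        refine not_partFrob_of_sum_eq [4, 4] (List.replicate m 4 ++ List.replicate q 3) [3, 3, 2]
          (by simp only [partList, List.replicate_add, List.append_assoc]; rfl) rfl (by simp)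
          (by simp; omega)
      · obtain ⟨m, rfl⟩ : ∃ m, i = m + 1 := ⟨i - 1, by omega⟩
        refine not_partFrob_of_sum_eq [4] (List.replicate m 4) [4]
          (by simp only [partList, List.replicate_add, List.append_assoc]; rfl) rfl (by simp)
          (by simp; omega)
      · obtain ⟨q, rfl⟩ : ∃ q, j = 1 + q + 2 := ⟨j - 3, by omega⟩
        refine not_partFrob_of_local [4, 3] (List.replicate q 3) [3, 3]
          (by simp only [partList, List.replicate_add, List.append_assoc]; rfl) (by simp; omega) ?_
        exact not_frob_3_3_4_3 (by simp; omega)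
      · obtain ⟨m, rfl⟩ : ∃ m, i = 1 + m := ⟨i - 1, by omega⟩
        obtain ⟨q, rfl⟩ : ∃ q, j = q + 3 := ⟨j - 3, by omega⟩
        refine not_partFrob_of_local [4, 4] (List.replicate m 4 ++ List.replicate q 3) [3, 3, 3]
          (by simp only [partList, List.replicate_add, List.append_assoc]; rfl) (by simp; omega) ?_
        exact not_frob_3_3_3_4_4 (by simp; omega)
  · rintro (⟨rfl, rfl, rfl⟩ | ⟨rfl, rfl, rfl⟩ | ⟨rfl, rfl, rfl⟩ | ⟨rfl, rfl, rfl⟩ |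
      ⟨rfl, rfl, rfl⟩)
    · obtain ⟨m, rfl⟩ : ∃ m, i = m + 1 := ⟨i - 1, by omega⟩
      exact partFrob_four_one m
    · obtain ⟨m, rfl⟩ : ∃ m, i = m + 1 := ⟨i - 1, by omega⟩
      exact partFrob_four_one_one m
    · obtain ⟨m, rfl⟩ : ∃ m, i = m + 2 := ⟨i - 2, by omega⟩
      exact partFrob_four_three_two m
    · obtain ⟨m, rfl⟩ : ∃ m, i = m + 2 := ⟨i - 2, by omega⟩
      exact partFrob_four_three m
    · obtain ⟨m, rfl⟩ : ∃ m, i = m + 3 := ⟨i - 3, by omega⟩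
      exact partFrob_four_three_three m

end Classification

end Seaweed

/-! ### Counting partitions through their multiplicities. -/

namespace Seaweed

theorem pairwise_partList (i j k l : ℕ) : (partList i j k l).Pairwise (· ≥ ·) := by
  simp only [partList, List.pairwise_append, List.pairwise_replicate, List.mem_append,
    List.mem_replicate]
  grind

theorem parts_eq_partList {n : ℕ} (p : n.Partition) (h : ∀ m ∈ p.parts, m ≤ 4) :
    p.parts = partList (p.parts.count 4) (p.parts.count 3) (p.parts.count 2) (p.parts.count 1) := by
  ext m
  by_cases hm : m ∈ p.parts
  · have h1 := p.parts_pos hm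
    have h4 := h m hm
    simp only [partList, Multiset.coe_count, List.count_append, List.count_replicate]
    interval_cases m <;> simp
  · rw [Multiset.count_eq_zero_of_notMem hm]
    simp only [partList, Multiset.coe_count, List.count_append, List.count_replicate]
    have h0 : ∀ c, (if (c == m) = true then p.parts.count c else 0) = 0 := by
      intro c
      by_cases hc : c = m
      · subst hc; simpa using hm
      · simp [hc]
    rw [h0, h0, h0, h0]

theorem sort_parts_eq_partList {n : ℕ} (p : n.Partition) (h : ∀ m ∈ p.parts, m ≤ 4) :
    p.parts.sort (· ≥ ·) = partList (p.parts.count 4) (p.parts.count 3) (p.parts.count 2)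
      (p.parts.count 1) := by
  refine List.Perm.eq_of_pairwise' (r := (· ≥ ·)) (Multiset.pairwise_sort _ _)
    (pairwise_partList _ _ _ _) (Multiset.coe_eq_coe.1 ?_)
  rw [Multiset.sort_eq]
  exact parts_eq_partList p h

/-- The multiplicities of the Frobenius partitions of `n` with parts at most `d`. -/
def frobeniusCounts (n d : ℕ) : Set (ℕ × ℕ × ℕ × ℕ) :=
  {q | (4 * q.1 + 3 * q.2.1 + 2 * q.2.2.1 + q.2.2.2 = n ∧ PartFrob q.1 q.2.1 q.2.2.1 q.2.2.2) ∧
    (d < 4 → q.1 = 0) ∧ (d < 3 → q.2.1 = 0) ∧ (d < 2 → q.2.2.1 = 0)}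

/-- A partition with parts at most 4 is determined by its four multiplicities, and its sorted list
of parts is the corresponding `partList`. -/
theorem ncard_frobeniusPartitions {n d : ℕ} (hn : 0 < n) (hd : 1 ≤ d) (hd4 : d ≤ 4) :
    (frobeniusPartitions n d).ncard = (frobeniusCounts n d).ncard := by
  let c : n.Partition → ℕ × ℕ × ℕ × ℕ := fun p =>
    (p.parts.count 4, p.parts.count 3, p.parts.count 2, p.parts.count 1)
  have hinj : Set.InjOn c (frobeniusPartitions n d) := by
    intro p hp q hq hpq
    simp only [c, Prod.mk.injEq] at hpq
    obtain ⟨h4, h3, h2, h1⟩ := hpq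
    apply Nat.Partition.ext
    rw [parts_eq_partList p fun m hm => (hp.2 m hm).trans hd4,
      parts_eq_partList q fun m hm => (hq.2 m hm).trans hd4, h4, h3, h2, h1]
  rw [← hinj.ncard_image]
  congr 1
  ext ⟨i, j, k, l⟩
  constructor
  · rintro ⟨p, ⟨hp, hpd⟩, hc⟩
    have hp4 : ∀ m ∈ p.parts, m ≤ 4 := fun m hm => (hpd m hm).trans hd4
    have hsum := p.parts_sum
    rw [parts_eq_partList p hp4, Multiset.sum_coe, sum_partList] at hsum
    rw [isFrobenius_iff hn, sort_parts_eq_partList p hp4] at hp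
    simp only [c, Prod.mk.injEq] at hc
    obtain ⟨rfl, rfl, rfl, rfl⟩ := hc
    have hz : ∀ m, d < m → p.parts.count m = 0 := fun m hm =>
      Multiset.count_eq_zero_of_notMem fun h => absurd (hpd m h) (by omega)
    refine ⟨⟨hsum, ?_⟩, hz 4, hz 3, hz 2⟩
    rw [PartFrob, hsum]
    exact hp
  · rintro ⟨⟨hsum, hF⟩, h4, h3, h2⟩
    dsimp only at hsum hF h4 h3 h2
    let p : n.Partition :=
      { parts := partList i j k l
        parts_pos := fun {m} hm => by
          simp only [partList, Multiset.mem_coe, List.mem_append, List.mem_replicate] at hm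
          omega
        parts_sum := by rw [Multiset.sum_coe, sum_partList, hsum] }
    have hc : c p = (i, j, k, l) := by
      simp [c, p, partList, List.count_replicate]
    have hpd : ∀ m ∈ p.parts, m ≤ d := by
      intro m hm
      simp only [p, partList, Multiset.mem_coe, List.mem_append, List.mem_replicate] at hm
      omega
    refine ⟨p, ⟨?_, hpd⟩, hc⟩
    have hp4 : ∀ m ∈ p.parts, m ≤ 4 := fun m hm => (hpd m hm).trans hd4
    simp only [c, Prod.mk.injEq] at hc
    rw [isFrobenius_iff hn, sort_parts_eq_partList p hp4, hc.1, hc.2.1, hc.2.2.1, hc.2.2.2]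
    rw [PartFrob, hsum] at hF
    exact hF

theorem mem_frobeniusCounts_four_iff {n i j k l : ℕ} (hn : 17 ≤ n) :
    (i, j, k, l) ∈ frobeniusCounts n 4 ↔ 4 * i + 3 * j + 2 * k + l = n ∧
      (i = 0 ∧ j = 0 ∧ l = 1 ∨ i = 0 ∧ j = 1 ∧ l = 0 ∨
      j = 0 ∧ k = 0 ∧ l = 1 ∨ j = 0 ∧ k = 0 ∧ l = 2 ∨ j = 1 ∧ k = 1 ∧ l = 0 ∨
      j = 1 ∧ k = 0 ∧ l = 0 ∨ j = 2 ∧ k = 0 ∧ l = 0) := by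
  simp only [frobeniusCounts, Set.mem_ofPred_eq, lt_self_iff_false, false_imp_iff, Nat.reduceLT,
    and_true]
  refine and_congr_right fun h => ?_
  rcases Nat.eq_zero_or_pos i with rfl | hi
  · rcases Nat.eq_zero_or_pos j with rfl | hj
    · rw [partFrob_twos_iff (by omega)]
      omega
    · rw [partFrob_threes_iff hj (by omega)]
      omega
  · rw [partFrob_fours_iff hi (by omega)]
    simp only [hi.ne', false_and, false_or]

theorem mem_frobeniusCounts_three_iff {n i j k l : ℕ} (hn : 13 ≤ n) :
    (i, j, k, l) ∈ frobeniusCounts n 3 ↔ 4 * i + 3 * j + 2 * k + l = n ∧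
      (i = 0 ∧ j = 0 ∧ l = 1 ∨ i = 0 ∧ j = 1 ∧ l = 0) := by
  simp only [frobeniusCounts, Set.mem_ofPred_eq, lt_self_iff_false, false_imp_iff, and_assoc,
    Nat.reduceLT, and_true, true_imp_iff]
  refine and_congr_right fun h => ?_
  rcases Nat.eq_zero_or_pos i with rfl | hi
  · rcases Nat.eq_zero_or_pos j with rfl | hj
    · rw [partFrob_twos_iff (by omega)]
      omega
    · rw [partFrob_threes_iff hj (by omega)]
      omega
  · omega

theorem mem_frobeniusCounts_two_iff {n i j k l : ℕ} (hn : 5 ≤ n) :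
    (i, j, k, l) ∈ frobeniusCounts n 2 ↔ 4 * i + 3 * j + 2 * k + l = n ∧
      (i = 0 ∧ j = 0 ∧ l = 1) := by
  simp only [frobeniusCounts, Set.mem_ofPred_eq, lt_self_iff_false, false_imp_iff, and_assoc,
    Nat.reduceLT, and_true, true_imp_iff]
  refine and_congr_right fun h => ?_
  constructor
  · rintro ⟨h1, rfl, rfl⟩
    exact ⟨rfl, rfl, (partFrob_twos_iff (by omega)).1 h1⟩
  · rintro ⟨rfl, rfl, rfl⟩
    exact ⟨(partFrob_twos_iff (by omega)).2 rfl, rfl, rfl⟩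

theorem frobeniusCounts_one {n : ℕ} (hn : 3 ≤ n) : frobeniusCounts n 1 = ∅ := by
  ext ⟨i, j, k, l⟩
  simp only [frobeniusCounts, Set.mem_ofPred_eq, Nat.reduceLT, true_imp_iff,
    Set.mem_empty_iff_false, iff_false]
  rintro ⟨⟨h, hF⟩, rfl, rfl, rfl⟩
  exact not_partFrob_ones (by omega) hF

theorem ncard_one {n : ℕ} (hn : 3 ≤ n) : (frobeniusPartitions n 1).ncard = 0 := by
  rw [ncard_frobeniusPartitions (by omega) le_rfl (by omega), frobeniusCounts_one hn,
    Set.ncard_empty]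

theorem ncard_two {n : ℕ} (hn : 5 ≤ n) :
    (frobeniusPartitions n 2).ncard = if Odd n then 1 else 0 := by
  rw [ncard_frobeniusPartitions (by omega) (by omega) (by omega)]
  split_ifs with h <;> rw [Nat.odd_iff] at h
  · rw [show frobeniusCounts n 2 = {(0, 0, n / 2, 1)} by
      ext ⟨i, j, k, l⟩
      rw [mem_frobeniusCounts_two_iff hn]
      simp only [Set.mem_singleton_iff, Prod.mk.injEq]
      omega, Set.ncard_singleton]
  · rw [show frobeniusCounts n 2 = ∅ by
      ext ⟨i, j, k, l⟩
      rw [mem_frobeniusCounts_two_iff hn]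
      simp only [Set.mem_empty_iff_false, iff_false]
      omega, Set.ncard_empty]

theorem ncard_three {n : ℕ} (hn : 13 ≤ n) :
    (frobeniusPartitions n 3).ncard = if Odd n then 2 else 0 := by
  rw [ncard_frobeniusPartitions (by omega) (by omega) (by omega)]
  split_ifs with h <;> rw [Nat.odd_iff] at h
  · rw [show frobeniusCounts n 3 = {(0, 0, n / 2, 1), (0, 1, n / 2 - 1, 0)} by
      ext ⟨i, j, k, l⟩
      rw [mem_frobeniusCounts_three_iff hn]
      simp only [Set.mem_insert_iff, Set.mem_singleton_iff, Prod.mk.injEq]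
      omega, Set.ncard_pair (by simp)]
  · rw [show frobeniusCounts n 3 = ∅ by
      ext ⟨i, j, k, l⟩
      rw [mem_frobeniusCounts_three_iff hn]
      simp only [Set.mem_empty_iff_false, iff_false]
      omega, Set.ncard_empty]

theorem frobeniusCounts_four_mod_one {n : ℕ} (hn : 17 ≤ n) (h : n % 4 = 1) :
    frobeniusCounts n 4 = {(n / 4, 0, 0, 1), (n / 4 - 1, 1, 1, 0), (0, 0, n / 2, 1),
      (0, 1, n / 2 - 1, 0)} := by
  ext ⟨i, j, k, l⟩
  rw [mem_frobeniusCounts_four_iff hn]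
  simp only [Set.mem_insert_iff, Set.mem_singleton_iff, Prod.mk.injEq]
  constructor
  · rintro ⟨h1, h2 | h2 | h2 | h2 | h2 | h2 | h2⟩ <;> omega
  · rintro (h2 | h2 | h2 | h2) <;> omega

theorem frobeniusCounts_four_mod_two {n : ℕ} (hn : 17 ≤ n) (h : n % 4 = 2) :
    frobeniusCounts n 4 = {(n / 4, 0, 0, 2), (n / 4 - 1, 2, 0, 0)} := by
  ext ⟨i, j, k, l⟩
  rw [mem_frobeniusCounts_four_iff hn]
  simp only [Set.mem_insert_iff, Set.mem_singleton_iff, Prod.mk.injEq]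
  constructor
  · rintro ⟨h1, h2 | h2 | h2 | h2 | h2 | h2 | h2⟩ <;> omega
  · rintro (h2 | h2) <;> omega

theorem frobeniusCounts_four_mod_three {n : ℕ} (hn : 17 ≤ n) (h : n % 4 = 3) :
    frobeniusCounts n 4 = {(n / 4, 1, 0, 0), (0, 0, n / 2, 1), (0, 1, n / 2 - 1, 0)} := by
  ext ⟨i, j, k, l⟩
  rw [mem_frobeniusCounts_four_iff hn]
  simp only [Set.mem_insert_iff, Set.mem_singleton_iff, Prod.mk.injEq]
  constructor
  · rintro ⟨h1, h2 | h2 | h2 | h2 | h2 | h2 | h2⟩ <;> omega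
  · rintro (h2 | h2 | h2) <;> omega

theorem frobeniusCounts_four_mod_zero {n : ℕ} (hn : 17 ≤ n) (h : n % 4 = 0) :
    frobeniusCounts n 4 = ∅ := by
  ext ⟨i, j, k, l⟩
  rw [mem_frobeniusCounts_four_iff hn]
  simp only [Set.mem_empty_iff_false, iff_false]
  rintro ⟨h1, h2 | h2 | h2 | h2 | h2 | h2 | h2⟩ <;> omega

theorem ncard_four {n : ℕ} (hn : 17 ≤ n) :
    (n % 4 = 1 → (frobeniusPartitions n 4).ncard = 4) ∧
    (n % 4 = 2 → (frobeniusPartitions n 4).ncard = 2) ∧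
    (n % 4 = 3 → (frobeniusPartitions n 4).ncard = 3) ∧
    (n % 4 = 0 → (frobeniusPartitions n 4).ncard = 0) := by
  rw [ncard_frobeniusPartitions (by omega) (by omega) le_rfl]
  refine ⟨fun h => ?_, fun h => ?_, fun h => ?_, fun h => ?_⟩
  · rw [frobeniusCounts_four_mod_one hn h, Set.ncard_insert_of_notMem, Set.ncard_insert_of_notMem,
      Set.ncard_pair] <;> simp <;> omega
  · rw [frobeniusCounts_four_mod_two hn h, Set.ncard_pair (by simp)]
  · rw [frobeniusCounts_four_mod_three hn h, Set.ncard_insert_of_notMem, Set.ncard_pair] <;>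
      simp <;> omega
  · rw [frobeniusCounts_four_mod_zero hn h, Set.ncard_empty]

end Seaweed

theorem theorem3p4 :
    (∀ d ∈ ({1, 2, 3, 4} : Set ℕ), ∃ N T : ℕ, 0 < T ∧ ∀ n ≥ N,
      (Seaweed.frobeniusPartitions (n + T) d).ncard = (Seaweed.frobeniusPartitions n d).ncard) ∧
    (∀ n ≥ 3, (Seaweed.frobeniusPartitions n 1).ncard = 0) ∧
    (∀ n ≥ 5, (Seaweed.frobeniusPartitions n 2).ncard = if Odd n then 1 else 0) ∧
    (∀ n ≥ 13, (Seaweed.frobeniusPartitions n 3).ncard = if Odd n then 2 else 0) ∧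
    (∀ n ≥ 17,
      (n % 4 = 1 → (Seaweed.frobeniusPartitions n 4).ncard = 4) ∧
      (n % 4 = 2 → (Seaweed.frobeniusPartitions n 4).ncard = 2) ∧
      (n % 4 = 3 → (Seaweed.frobeniusPartitions n 4).ncard = 3) ∧
      (n % 4 = 0 → (Seaweed.frobeniusPartitions n 4).ncard = 0)) := by
  refine ⟨?_, fun n hn => Seaweed.ncard_one hn, fun n hn => Seaweed.ncard_two hn,
    fun n hn => Seaweed.ncard_three hn, fun n hn => Seaweed.ncard_four hn⟩
  rintro d (rfl | rfl | rfl | rfl)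
  · exact ⟨3, 1, one_pos, fun n hn => by
      rw [Seaweed.ncard_one hn, Seaweed.ncard_one (by omega)]⟩
  · exact ⟨5, 2, two_pos, fun n hn => by
      rw [Seaweed.ncard_two hn, Seaweed.ncard_two (by omega)]
      simp [Nat.odd_iff]⟩
  · exact ⟨13, 2, two_pos, fun n hn => by
      rw [Seaweed.ncard_three hn, Seaweed.ncard_three (by omega)]
      simp [Nat.odd_iff]⟩
  · refine ⟨17, 4, four_pos, fun n hn => ?_⟩
    obtain ⟨h1, h2, h3, h4⟩ := Seaweed.ncard_four hn
    obtain ⟨g1, g2, g3, g4⟩ := Seaweed.ncard_four (n := n + 4) (by omega)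
    rw [Nat.add_mod_right] at g1 g2 g3 g4
    rcases (by omega : n % 4 = 1 ∨ n % 4 = 2 ∨ n % 4 = 3 ∨ n % 4 = 0) with h | h | h | h
    · rw [g1 h, h1 h]
    · rw [g2 h, h2 h]
    · rw [g3 h, h3 h]
    · rw [g4 h, h4 h]
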